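/- Let $A$ be a commutative $\mathbb Q$-algebra (of functions of $t=(t_1,t_2,\dots)$) with commuting derivations $\partial_1,\partial_2,\dots$, let $\tau\in A$ be invertible, and let $\log\tau\in A$ be a logarithm of $\tau$, i.e. $\partial_n\tau=\tau\,\partial_n\log\tau$ for all $n\ge 1$. Put $u=\partial_1^2\log\tau$, $\tilde\partial=(\partial_1,\tfrac12\partial_2,\tfrac13\partial_3,\dots)$, and let the Schur polynomials $p_n$ be given by $\sum_{n\ge0}p_n(y)z^n=\exp\big(\sum_{k\ge1}y_kz^k\big)$. The KP Hirota equations for $\tau$ are $$\sum_{n\ge0}p_n(-2y)\,p_{n+1}(\tilde D)\,\exp\Big(\sum_{i\ge1}y_iD_i\Big)\tau\cdot\tau=0\quad\text{(identically in } y_1,y_2,\dots),$$ where $\tilde D=(D_1,\tfrac12D_2,\tfrac13D_3,\dots)$ and $D^\alpha a\cdot b=\sum_{\beta\le\alpha}\binom{\alpha}{\beta}(-1)^{|\alpha-\beta|}(\partial^\beta a)(\partial^{\alpha-\beta}b)$, that is, $D^\alpha a\cdot b=\partial_s^\alpha\, a(t+s)\,b(t-s)|_{s=0}$. Set $$Z_j=\sum_{k+m=j,\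 k,m\ge1}p_k(-\tilde\partial)\,p_m(-\tilde\partial)\log\tau ,\qquad j\ge 1.$$ (a) If $\tau$ satisfies the KP Hirota equations, then for all $i\ge2$ $$p_i(Z_1,Z_2,\dots)=\sum_{n+\ell=i-1,\ n\ge1,\ \ell\ge0}p_\ell(-\tilde\partial)\,\partial_n\partial_1\log\tau .\qquad(*)$$ (b) Suppose that $\partial_1^{-1}$ makes sense on the functions concerned: all $\partial_n\log\tau$, $n\ge1$, lie in a (not necessarily unital) $\mathbb Q$-subalgebra $I\subseteq A$ which is stable under all $\partial_n$ and on which $\partial_1$ is injective. Then the KP Hirota equations for $\tau$ are equivalent to $(*)$ for all $i\ge2$. They are also equivalent to the following equations in $u$ alone: for all $i\ge2$ $$p_i\big(Z_1(u),Z_2(u),\dots\big)=\sum_{n+\ell=i-1,\ n\ge1,\ \ell\ge0}\partial_1^{-1}p_\ell(-\tilde\partial)\,\partial_n u,\qquad Z_j(u)=\sum_{k+m=j,\ k,m\ge1}\partial_1^{-2}p_k(-\tilde\partial)\,p_m(-\tilde\partial)u ,$$ where, for $f$ in $A$, $\partial_1^{-1}f$ and $\partial_1^{-2}f$ denote the unique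 elements $g$ of $I$ with $\partial_1g=f$, respectively $\partial_1^2g=f$ (their existence for the right-hand sides and the $Z_j(u)$ being part of the equations). -/

import Mathlib

open Finset

noncomputable section

/-- The elementary Schur polynomial `p_n(y) = ∑ ∏ y_i ^ k_i / k_i!`, the sum being over all
`(k_1, k_2, …)` with `∑ i k_i = n`, i.e. over the partitions of `n` (`k_i` is the number of parts
equal to `i`). Parts are positive, so the variable with index `0` does not occur. -/
def schurPoly (n : ℕ) : MvPolynomial ℕ ℚ :=
  ∑ π : n.Partition, ∏ i ∈ π.parts.toFinset,
    MvPolynomial.C (1 / ((π.parts.count i).factorial : ℚ)) *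
      MvPolynomial.X i ^ π.parts.count i

/-- The value `p_n(y)` at a sequence `y = (y_1, y_2, …)` in a commutative `ℚ`-algebra. -/
def schurEval {R : Type*} [CommRing R] [Algebra ℚ R] (n : ℕ) (y : ℕ → R) : R :=
  MvPolynomial.aeval y (schurPoly n)

/-- The polynomial `p_n(-ỹ)`, where `ỹ = (y_1, y_2 / 2, y_3 / 3, …)`. -/
def schurNegTilde (n : ℕ) : MvPolynomial ℕ ℚ :=
  schurEval n fun k => -(MvPolynomial.C (1 / (k : ℚ)) * MvPolynomial.X k)

/-- The polynomial `p_n(ỹ)`, where `ỹ = (y_1, y_2 / 2, y_3 / 3, …)`. -/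
def schurTilde (n : ℕ) : MvPolynomial ℕ ℚ :=
  schurEval n fun k => MvPolynomial.C (1 / (k : ℚ)) * MvPolynomial.X k

section DifferentialAlgebra

variable {A : Type*} [CommRing A] [Algebra ℚ A]

/-- The operator `∂^s = ∏ ∂_i ^ s_i` (composed in increasing order of the index; the order is
immaterial for commuting derivations). -/
def monomialOp (d : ℕ → Derivation ℚ A A) (s : ℕ →₀ ℕ) : Module.End ℚ A :=
  ((s.support.sort (· ≤ ·)).map fun i => ((d i : A →ₗ[ℚ] A) : Module.End ℚ A) ^ s i).prod

/-- The constant-coefficient operator `P(∂_1, ∂_2, …)` of a polynomial `P`. -/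
def polyOp (d : ℕ → Derivation ℚ A A) (P : MvPolynomial ℕ ℚ) : Module.End ℚ A :=
  ∑ s ∈ P.support, P.coeff s • monomialOp d s

/-- The operator `p_n(-∂̃)`, where `∂̃ = (∂_1, ∂_2 / 2, ∂_3 / 3, …)`. -/
def schurOp (d : ℕ → Derivation ℚ A A) (n : ℕ) : Module.End ℚ A :=
  polyOp d (schurNegTilde n)

/-- The bilinear Hirota monomial `D^s a · b = ∂_x^s a(t + x) b(t - x) |_{x = 0}`, expanded by the
Leibniz rule. -/
def hirotaMonomial (d : ℕ → Derivation ℚ A A) (s : ℕ →₀ ℕ) (a b : A) : A :=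
  ∑ p ∈ antidiagonal s,
    ((-1 : ℚ) ^ (p.2.sum fun _ k => k) * s.prod fun i k => (k.choose (p.1 i) : ℚ)) •
      (monomialOp d p.1 a * monomialOp d p.2 b)

/-- The bilinear Hirota expression `P(D_1, D_2, …) a · b` of a polynomial `P`. -/
def hirotaBilinear (d : ℕ → Derivation ℚ A A) (P : MvPolynomial ℕ ℚ) (a b : A) : A :=
  ∑ s ∈ P.support, P.coeff s • hirotaMonomial d s a b

end DifferentialAlgebra

/-- The weight `∑ i s_i` of a multi-index. -/
def multiWeight (s : ℕ →₀ ℕ) : ℕ := s.sum fun i k => i * k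

/-- The coefficient of `y^s` in `∑_n p_n(-2y) p_{n+1}(D̃) exp(∑ y_i D_i)`, a polynomial in the
`D_i`. As `p_n(-2y)` is homogeneous of weight `n`, the terms with `n > multiWeight s` do not
contribute. -/
def kpHirotaPoly (s : ℕ →₀ ℕ) : MvPolynomial ℕ ℚ :=
  ∑ n ∈ range (multiWeight s + 1), ∑ p ∈ antidiagonal s,
    MvPolynomial.C
        (MvPolynomial.coeff p.1
          (schurEval n fun k => -2 * (MvPolynomial.X k : MvPolynomial ℕ ℚ))) *
      schurTilde (n + 1) *
      MvPolynomial.monomial p.2 (1 / p.2.prod fun _ k => (k.factorial : ℚ))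

section KP

variable {A : Type*} [CommRing A] [Algebra ℚ A]

/-- The KP Hirota equations
`∑_n p_n(-2y) p_{n+1}(D̃) exp(∑ y_i D_i) τ · τ = 0`: the coefficient of every monomial in
`y_1, y_2, …` vanishes. -/
def KPHirota (d : ℕ → Derivation ℚ A A) (τ : A) : Prop :=
  ∀ s : ℕ →₀ ℕ, s 0 = 0 → hirotaBilinear d (kpHirotaPoly s) τ τ = 0

/-- `∑_{k + m = j, k, m ≥ 1} p_k(-∂̃) p_m(-∂̃) f`. -/
def zSum (d : ℕ → Derivation ℚ A A) (f : A) (j : ℕ) : A :=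
  ∑ p ∈ antidiagonal j with 1 ≤ p.1 ∧ 1 ≤ p.2, schurOp d p.1 (schurOp d p.2 f)

/-- `∑_{n + ℓ = i - 1, n ≥ 1, ℓ ≥ 0} p_ℓ(-∂̃) ∂_n f`. -/
def rSum (d : ℕ → Derivation ℚ A A) (f : A) (i : ℕ) : A :=
  ∑ p ∈ antidiagonal (i - 1) with 1 ≤ p.1, schurOp d p.2 (d p.1 f)

/-- The equations `p_i(Z_j) = ∑_{n + ℓ = i - 1} p_ℓ(-∂̃) ∂_n ∂_1 F` with
`Z_j = ∑_{k + m = j} p_k(-∂̃) p_m(-∂̃) F`, for `F = log τ`. -/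
def LogTauEquations (d : ℕ → Derivation ℚ A A) (F : A) : Prop :=
  ∀ i, 2 ≤ i → schurEval i (zSum d F) = rSum d (d 1 F) i

/-- The equations `p_i(Z_j(u)) = ∑_{n + ℓ = i - 1} ∂_1⁻¹ p_ℓ(-∂̃) ∂_n u` with
`Z_j(u) = ∑_{k + m = j} ∂_1⁻² p_k(-∂̃) p_m(-∂̃) u`. Here `∂_1⁻¹` is the inverse of `∂_1` on a
space `I` that is closed under `∂_1` and on which `∂_1` is injective: the elements `Z j` and `R i`
of `I` are then determined by their prescribed derivatives. -/
def UEquations (d : ℕ → Derivation ℚ A A) (I : NonUnitalSubalgebra ℚ A) (u : A) : Prop :=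
  ∃ Z R : ℕ → A,
    (∀ j, Z j ∈ I ∧ d 1 (d 1 (Z j)) = zSum d u j) ∧
    (∀ i, R i ∈ I ∧ d 1 (R i) = rSum d u i) ∧
    ∀ i, 2 ≤ i → schurEval i Z = R i

end KP

end

/-! Write [z] = (z, z²/2, z³/3, …) and λ = 1/z. Then exp(c ∑ z^k ∂_k / k) a is a(t + c[z]),
formalised as `shift`.

Reformulation. The operators ∂_i ⊗ 1 + 1 ⊗ ∂_i act on a product a · b as the derivation ∂_i.
Multiplying the Hirota generating function by an exponential in them therefore does not affect its
vanishing. After this and a rescaling of y, the Hirota equations become the bilinear identity Res_λ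
(Q(∂_i + λ^i) τ(t - [z])) τ(t + [z]) = 0 for all polynomials Q (`kpHirota_iff`). On the other side,
exp ∑ Z_j z^j = τ(t - 2[z]) τ(t) / τ(t - [z])² (`IsLog.schurSeries_zSeries`). So (*) says that this
quotient is 1 + z² ∑ z^i (∂_{i+1} ∂_1 F)(t - [z]), with F = log τ.

From Hirota to (*). Take Q = y_1 p_n(2ỹ). The shift by 2[x] contributes the factor (1 - λx)^(-2), so
the residue is a second difference evaluated on the diagonal. It gives a formula for τ(t + 2[z])
τ(t) - τ(t + [z])² (`IsLog.shift_identity`). Translating by -2[z] and dividing by τ(t - [z])² gives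
(*).

From (*) to Hirota. Equation (*) is the diagonal x = z of the differential Fay identity for τ(t -
[x] - [z]) τ(t) / (τ(t - [x]) τ(t - [z])). A compatibility relation (`IsDressing.fay_consistency`)
shows that, once the defect vanishes in lower total degrees, its interior coefficients of the next
degree all have the same ∂_1-derivative. The coefficients on the edges vanish and the diagonal
forces the sum to vanish. Hence that derivative is zero, and injectivity of ∂_1 on I kills the
coefficients (`IsDressing.fayDefect_eq_zero`).

The full Fay identity amounts to linear equations for w = τ(t - [z]) / τ(t). A series c is built
recursively so that w pairs to zero with c under all powers of ∂_1 + λ. The linear equations extend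
this to all Q (`IsDressing.mem_residueKernel`). Testing with Q = p_n(ỹ) then identifies c as τ(t +
[z]) / τ(t), which is the residue identity. -/

open scoped TensorProduct

noncomputable section

/-! ### Multi-indices and Schur polynomials -/

/-- The product `∏ s_i!` of the factorials of a multi-index. -/
def multiFactorial (s : ℕ →₀ ℕ) : ℕ := s.prod fun _ k => k.factorial

theorem multiFactorial_ne_zero (s : ℕ →₀ ℕ) : multiFactorial s ≠ 0 :=
  Finset.prod_ne_zero_iff.2 fun _ _ => Nat.factorial_ne_zero _

theorem multiFactorial_add_single (s : ℕ →₀ ℕ) (i : ℕ) :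
    multiFactorial (s + Finsupp.single i 1) = (s i + 1) * multiFactorial s := by
  classical
  unfold multiFactorial
  have h1 : ∀ t : ℕ →₀ ℕ, t.support ⊆ insert i s.support →
      (t.prod fun _ k => k.factorial) =
        (t i).factorial * ∏ j ∈ s.support.erase i, (t j).factorial := by
    intro t ht
    rw [Finsupp.prod_of_support_subset t ht _ (by simp),
      ← Finset.mul_prod_erase _ _ (Finset.mem_insert_self i _),
      Finset.erase_insert_eq_erase]
  rw [h1 s (Finset.subset_insert _ _), h1 (s + Finsupp.single i 1), ← mul_assoc]
  · congr 1
    · simp [Nat.factorial_succ]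
    · refine Finset.prod_congr rfl fun j hj => ?_
      have : i ≠ j := fun h => (Finset.mem_erase.1 hj).1 h.symm
      simp [this]
  · intro j hj
    by_cases hij : i = j
    · simp [hij]
    · simp only [Finsupp.mem_support_iff, Finsupp.add_apply, Finsupp.single_apply, hij, if_false,
        add_zero] at hj
      simp [hj]

theorem multiWeight_add (s t : ℕ →₀ ℕ) : multiWeight (s + t) = multiWeight s + multiWeight t :=
  Finsupp.sum_add_index' (by simp) (by intros; ring)

theorem multiWeight_single (i k : ℕ) : multiWeight (Finsupp.single i k) = i * k :=
  Finsupp.sum_single_index (by simp)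

theorem exists_add_single_of_ne_zero {s : ℕ →₀ ℕ} {i : ℕ} (h : s i ≠ 0) :
    ∃ t, s = t + Finsupp.single i 1 :=
  ⟨s - Finsupp.single i 1, (tsub_add_cancel_of_le (by
    rw [Finsupp.single_le_iff]; omega)).symm⟩

/-- `Multiset.toFinsupp` identifies the partitions of n with the multi-indices of weight n that
vanish at 0, so each monomial arises from at most one partition. -/
theorem coeff_schurPoly (n : ℕ) (s : ℕ →₀ ℕ) :
    MvPolynomial.coeff s (schurPoly n) =
      if s 0 = 0 ∧ multiWeight s = n then 1 / (multiFactorial s : ℚ) else 0 := by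
  classical
  have hterm : ∀ π : n.Partition, (∏ i ∈ π.parts.toFinset,
      MvPolynomial.C (1 / ((π.parts.count i).factorial : ℚ)) *
        MvPolynomial.X i ^ π.parts.count i : MvPolynomial ℕ ℚ) =
      MvPolynomial.monomial π.parts.toFinsupp (1 / (multiFactorial π.parts.toFinsupp : ℚ)) := by
    intro π
    rw [MvPolynomial.monomial_eq, Finset.prod_mul_distrib, ← map_prod]
    simp [multiFactorial, Finsupp.prod, Multiset.toFinsupp_support]
  have hw : ∀ m : Multiset ℕ, multiWeight m.toFinsupp = m.sum := by
    intro m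
    rw [multiWeight, Finsupp.sum, Multiset.toFinsupp_support, Finset.sum_multiset_count]
    exact Finset.sum_congr rfl fun i _ => by simp [mul_comm]
  simp_rw [schurPoly, hterm, MvPolynomial.coeff_sum, MvPolynomial.coeff_monomial]
  split_ifs with h
  · let π : n.Partition :=
      { parts := Finsupp.toMultiset s
        parts_pos := by
          intro i hi
          rcases Nat.eq_zero_or_pos i with rfl | hp
          · rw [Finsupp.mem_toMultiset] at hi
            simp [h.1] at hi
          · exact hp
        parts_sum := by rw [← hw, Finsupp.toMultiset_toFinsupp, h.2] }
    have hπ : π.parts.toFinsupp = s := Finsupp.toMultiset_toFinsupp s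
    rw [Finset.sum_eq_single π]
    · simp [hπ]
    · intro π' _ hne
      rw [if_neg]
      intro he
      apply hne
      ext1
      have : π'.parts = Finsupp.toMultiset s := by rw [← he, Multiset.toFinsupp_toMultiset]
      exact this
    · simp
  · refine Finset.sum_eq_zero fun π _ => if_neg fun he => h ?_
    subst he
    refine ⟨?_, by rw [hw, π.parts_sum]⟩
    rw [Multiset.toFinsupp_apply, Multiset.count_eq_zero]
    exact fun h0 => lt_irrefl _ (π.parts_pos h0)

/-- This is the z-derivative of exp(∑ y_k z^k). On coefficients it reduces to ∑ i s_i = n + 1 for a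
multi-index s of weight n + 1. -/
theorem schurPoly_succ (n : ℕ) :
    ((n + 1 : ℕ) : MvPolynomial ℕ ℚ) * schurPoly (n + 1) =
      ∑ p ∈ antidiagonal n,
        ((p.1 + 1 : ℕ) : MvPolynomial ℕ ℚ) * MvPolynomial.X (p.1 + 1) * schurPoly p.2 := by
  classical
  ext s
  have hcast : ∀ (k : ℕ) (q : MvPolynomial ℕ ℚ) (s : ℕ →₀ ℕ),
      MvPolynomial.coeff s ((k : MvPolynomial ℕ ℚ) * q) = k * MvPolynomial.coeff s q := by
    intro k q s
    rw [← map_natCast (MvPolynomial.C (σ := ℕ) (R := ℚ)), MvPolynomial.coeff_C_mul]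
  simp_rw [mul_assoc, MvPolynomial.coeff_sum, hcast, MvPolynomial.coeff_X_mul', coeff_schurPoly]
  have hterm : ∀ p ∈ antidiagonal n, ((p.1 + 1 : ℕ) : ℚ) *
      (if p.1 + 1 ∈ s.support then
        (if (s - Finsupp.single (p.1 + 1) 1 : ℕ →₀ ℕ) 0 = 0 ∧
            multiWeight (s - Finsupp.single (p.1 + 1) 1) = p.2 then
          1 / (multiFactorial (s - Finsupp.single (p.1 + 1) 1) : ℚ) else 0) else 0) =
      if s 0 = 0 ∧ multiWeight s = n + 1 then
        ((((p.1 + 1) * s (p.1 + 1) : ℕ) : ℚ)) / multiFactorial s else 0 := by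
    rintro ⟨i, j⟩ hp
    rw [HasAntidiagonal.mem_antidiagonal] at hp
    simp only at hp ⊢
    by_cases hs : s (i + 1) = 0
    · simp [hs]
    · obtain ⟨t, rfl⟩ := exists_add_single_of_ne_zero hs
      rw [if_pos (by simp), add_tsub_cancel_right, multiWeight_add, multiWeight_single,
        multiFactorial_add_single]
      have e0 : (t + Finsupp.single (i + 1) 1 : ℕ →₀ ℕ) 0 = t 0 := by simp
      have e1 : (multiWeight t + (i + 1) * 1 = n + 1) ↔ multiWeight t = j := by omega
      simp only [e0, e1]
      have h1 : (multiFactorial t : ℚ) ≠ 0 := by exact_mod_cast multiFactorial_ne_zero t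
      have h2 : ((t (i + 1) : ℚ) + 1) ≠ 0 := by positivity
      split_ifs with h
      · simp only [Finsupp.add_apply, Finsupp.single_eq_same]
        push_cast
        field_simp
      · simp
  rw [Finset.sum_congr rfl hterm]
  split_ifs with h
  · rw [← Finset.sum_div, ← Nat.cast_sum,
      Finset.Nat.sum_antidiagonal_eq_sum_range_succ_mk, ← h.2]
    simp only
    rw [mul_one_div]
    congr 2
    have hsub : s.support ⊆ range (n + 1 + 1) := by
      intro i hi
      have : i * s i ≤ multiWeight s :=
        Finset.single_le_sum (f := fun i => i * s i) (fun _ _ => Nat.zero_le _) hi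
      have h1 : 1 ≤ s i := Nat.one_le_iff_ne_zero.2 (Finsupp.mem_support_iff.1 hi)
      rw [Finset.mem_range]
      nlinarith [h.2]
    rw [multiWeight, Finsupp.sum_of_support_subset s hsub _ (by simp), Finset.sum_range_succ']
    simp
  · simp

/-! ### Generating series of Schur polynomials -/

section Evaluation

variable {S : Type*} [CommRing S] [Algebra ℚ S]

theorem schurEval_zero (y : ℕ → S) : schurEval 0 y = 1 := by
  have : schurPoly 0 = 1 := by
    ext s
    rw [coeff_schurPoly, MvPolynomial.coeff_one]
    by_cases h : 0 = s
    · subst h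
      simp [multiWeight, multiFactorial]
    · rw [if_neg h, if_neg]
      rintro ⟨h0, hw⟩
      apply h
      ext i
      rcases Nat.eq_zero_or_pos i with rfl | hi
      · exact h0.symm
      · by_contra hne
        obtain ⟨t, rfl⟩ := exists_add_single_of_ne_zero (Ne.symm hne)
        rw [multiWeight_add, multiWeight_single] at hw
        omega
  rw [schurEval, this, map_one]

theorem schurEval_succ (n : ℕ) (y : ℕ → S) :
    ((n + 1 : ℕ) : S) * schurEval (n + 1) y =
      ∑ p ∈ antidiagonal n, (((p.1 + 1 : ℕ) : S) * y (p.1 + 1)) * schurEval p.2 y := by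
  have := congrArg (MvPolynomial.aeval y) (schurPoly_succ n)
  simpa [schurEval] using this

theorem map_schurEval {S' : Type*} [CommRing S'] [Algebra ℚ S'] (g : S →ₐ[ℚ] S') (n : ℕ)
    (y : ℕ → S) : g (schurEval n y) = schurEval n fun k => g (y k) := by
  rw [schurEval, schurEval, ← MvPolynomial.comp_aeval_apply]

/-- The generating series `∑ p_n(y) z ^ n = exp (∑ y_k z ^ k)`. -/
def schurSeries (y : ℕ → S) : PowerSeries S := PowerSeries.mk fun n => schurEval n y

theorem coeff_schurSeries (n : ℕ) (y : ℕ → S) :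
    PowerSeries.coeff n (schurSeries y) = schurEval n y := PowerSeries.coeff_mk _ _

theorem derivative_schurSeries (y : ℕ → S) :
    PowerSeries.derivative S (schurSeries y) =
      PowerSeries.mk (fun i => ((i + 1 : ℕ) : S) * y (i + 1)) * schurSeries y := by
  ext n
  rw [PowerSeries.coeff_derivative, PowerSeries.coeff_mul]
  simp only [schurSeries, PowerSeries.coeff_mk]
  rw [← schurEval_succ, mul_comm]
  push_cast
  ring

theorem constantCoeff_schurSeries (y : ℕ → S) :
    PowerSeries.constantCoeff (schurSeries y) = 1 := by
  rw [← PowerSeries.coeff_zero_eq_constantCoeff_apply, schurSeries, PowerSeries.coeff_mk,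
    schurEval_zero]

theorem natCast_succ_mul_cancel {a b : S} (n : ℕ) (h : ((n + 1 : ℕ) : S) * a = (n + 1 : ℕ) * b) :
    a = b := by
  have : IsUnit ((n + 1 : ℕ) : S) := by
    rw [← map_natCast (algebraMap ℚ S)]
    exact IsUnit.map _ (IsUnit.mk0 _ (by positivity))
  exact this.mul_left_cancel h

/-- Two solutions of a first-order linear differential equation with the same initial value
agree. -/
theorem eq_of_derivative_eq_mul {g f h : PowerSeries S}
    (hf : PowerSeries.derivative S f = g * f) (hh : PowerSeries.derivative S h = g * h)
    (h0 : PowerSeries.constantCoeff f = PowerSeries.constantCoeff h) : f = h := by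
  ext n
  induction n using Nat.strong_induction_on with
  | _ n ih =>
    rcases n with _ | n
    · simpa using h0
    · apply natCast_succ_mul_cancel n
      have h1 := congrArg (PowerSeries.coeff n) hf
      have h2 := congrArg (PowerSeries.coeff n) hh
      rw [PowerSeries.coeff_derivative, PowerSeries.coeff_mul] at h1 h2
      push_cast
      rw [mul_comm, h1, mul_comm, h2]
      refine Finset.sum_congr rfl fun p hp => ?_
      have := HasAntidiagonal.mem_antidiagonal.1 hp
      rw [ih p.2 (by omega)]

/-- The exponential law: both sides solve the same linear differential equation in z with constant
term 1. -/
theorem schurSeries_add (y y' : ℕ → S) :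
    schurSeries (fun k => y k + y' k) = schurSeries y * schurSeries y' := by
  refine eq_of_derivative_eq_mul (derivative_schurSeries _) ?_ ?_
  · rw [Derivation.leibniz, derivative_schurSeries, derivative_schurSeries]
    have : PowerSeries.mk (fun i => ((i + 1 : ℕ) : S) * (y (i + 1) + y' (i + 1))) =
        PowerSeries.mk (fun i => ((i + 1 : ℕ) : S) * y (i + 1)) +
          PowerSeries.mk (fun i => ((i + 1 : ℕ) : S) * y' (i + 1)) := by
      ext n
      simp [mul_add]
    rw [this, smul_eq_mul, smul_eq_mul]
    ring
  · rw [map_mul, constantCoeff_schurSeries, constantCoeff_schurSeries, constantCoeff_schurSeries,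
      one_mul]

theorem schurEval_add (n : ℕ) (y y' : ℕ → S) :
    schurEval n (fun k => y k + y' k) =
      ∑ p ∈ antidiagonal n, schurEval p.1 y * schurEval p.2 y' := by
  rw [← coeff_schurSeries, schurSeries_add, PowerSeries.coeff_mul]
  simp only [coeff_schurSeries]

theorem schurEval_const_zero (n : ℕ) :
    schurEval n (fun _ => (0 : S)) = if n = 0 then 1 else 0 := by
  have : schurSeries (fun _ => (0 : S)) = 1 := by
    refine eq_of_derivative_eq_mul (g := 0) ?_ (by simp) (by simp [constantCoeff_schurSeries])
    rw [derivative_schurSeries]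
    congr 1
    ext
    simp
  rw [← coeff_schurSeries, this, PowerSeries.coeff_one]

/-- Solutions `y_k = x ^ k / k` give the geometric series. -/
theorem schurEval_geometric (n : ℕ) (x : S) :
    schurEval n (fun k => (1 / k : ℚ) • x ^ k) = x ^ n := by
  have : schurSeries (fun k => (1 / k : ℚ) • x ^ k) = PowerSeries.mk fun n => x ^ n := by
    refine eq_of_derivative_eq_mul (derivative_schurSeries _) ?_ ?_
    · ext n
      rw [PowerSeries.coeff_derivative, PowerSeries.coeff_mul]
      simp only [PowerSeries.coeff_mk]
      have : ∀ p ∈ antidiagonal n, ((p.1 + 1 : ℕ) : S) * ((1 / (p.1 + 1 : ℕ) : ℚ) • x ^ (p.1 + 1))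
          * x ^ p.2 = x ^ (n + 1) := by
        intro p hp
        have hp := HasAntidiagonal.mem_antidiagonal.1 hp
        have hc : ((p.1 + 1 : ℕ) : S) = algebraMap ℚ S (p.1 + 1 : ℕ) := by simp
        rw [hc, ← Algebra.smul_def, smul_smul, mul_one_div_cancel (by positivity), one_smul,
          ← pow_add, ← hp]
        congr 1
        omega
      rw [Finset.sum_congr rfl this, Finset.sum_const, Finset.Nat.card_antidiagonal, nsmul_eq_mul]
      push_cast
      ring
    · rw [constantCoeff_schurSeries, ← PowerSeries.coeff_zero_eq_constantCoeff_apply,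
        PowerSeries.coeff_mk, pow_zero]
  rw [← coeff_schurSeries, this, PowerSeries.coeff_mk]

end Evaluation

/-! ### Polynomials in commuting operators -/

section CommEval

variable {V : Type*} [AddCommGroup V] [Module ℚ V]

/-- The endomorphism ring is not commutative, but the subalgebra generated by the commuting family
is, and `MvPolynomial.aeval` applies there. -/
theorem exists_commEval (f : ℕ → Module.End ℚ V) (hf : ∀ m n, f m * f n = f n * f m) :
    ∃ g : MvPolynomial ℕ ℚ →ₐ[ℚ] Module.End ℚ V, ∀ n, g (MvPolynomial.X n) = f n := by
  have hcomm : ∀ a ∈ Set.range f, ∀ b ∈ Set.range f, a * b = b * a := by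
    rintro _ ⟨m, rfl⟩ _ ⟨n, rfl⟩
    exact hf m n
  have := Algebra.isMulCommutative_adjoin ℚ hcomm
  let _ : CommRing (Algebra.adjoin ℚ (Set.range f)) :=
    { (inferInstance : Ring (Algebra.adjoin ℚ (Set.range f))) with
      mul_comm := fun a b => this.is_comm.comm a b }
  refine ⟨(Algebra.adjoin ℚ (Set.range f)).val.comp
    (MvPolynomial.aeval fun n => ⟨f n, Algebra.subset_adjoin ⟨n, rfl⟩⟩), fun n => ?_⟩
  simp

/-- Evaluation of polynomials at a family of commuting endomorphisms. -/
def commEval (f : ℕ → Module.End ℚ V) (hf : ∀ m n, f m * f n = f n * f m) :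
    MvPolynomial ℕ ℚ →ₐ[ℚ] Module.End ℚ V := (exists_commEval f hf).choose

theorem commEval_X (f : ℕ → Module.End ℚ V) (hf : ∀ m n, f m * f n = f n * f m) (n : ℕ) :
    commEval f hf (MvPolynomial.X n) = f n := (exists_commEval f hf).choose_spec n

end CommEval

/-- A sequence of commuting derivations, the derivation with index `0` being zero. -/
structure CommDerivations (A : Type*) [CommRing A] [Algebra ℚ A] where
  der : ℕ → Derivation ℚ A A
  der_zero : der 0 = 0
  der_comm : ∀ m n f, der m (der n f) = der n (der m f)

/-- The polynomials `p_n(c ỹ)`, where `ỹ = (y_1, y_2 / 2, y_3 / 3, …)`. -/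
def schurScaled (c : ℚ) (n : ℕ) : MvPolynomial ℕ ℚ :=
  schurEval n fun k => MvPolynomial.C (c / (k : ℚ)) * MvPolynomial.X k

theorem schurScaled_zero (c : ℚ) : schurScaled c 0 = 1 := schurEval_zero _

theorem schurScaled_eq (c : ℚ) (n : ℕ) :
    schurScaled c n = schurEval n fun k => (c / (k : ℚ)) • MvPolynomial.X k := by
  simp only [schurScaled, MvPolynomial.smul_eq_C_mul]

theorem schurEval_scaled_succ {S : Type*} [CommRing S] [Algebra ℚ S] (c : ℚ) (n : ℕ)
    (y : ℕ → S) :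
    ((n + 1 : ℕ) : ℚ) • schurEval (n + 1) (fun k => (c / (k : ℚ)) • y k) =
      c • ∑ p ∈ antidiagonal n, y (p.1 + 1) * schurEval p.2 fun k => (c / (k : ℚ)) • y k := by
  rw [Algebra.smul_def, map_natCast, schurEval_succ, Finset.smul_sum]
  refine Finset.sum_congr rfl fun p _ => ?_
  rw [← smul_mul_assoc]
  congr 1
  rw [← map_natCast (algebraMap ℚ S), ← Algebra.smul_def, smul_smul,
    mul_div_cancel₀ c (by positivity)]

theorem schurScaled_succ (c : ℚ) (n : ℕ) :
    ((n + 1 : ℕ) : ℚ) • schurScaled c (n + 1) =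
      c • ∑ p ∈ antidiagonal n, MvPolynomial.X (p.1 + 1) * schurScaled c p.2 := by
  simp only [schurScaled_eq]
  exact schurEval_scaled_succ c n _

theorem schurScaled_add (c c' : ℚ) (n : ℕ) :
    schurScaled (c + c') n = ∑ p ∈ antidiagonal n, schurScaled c p.1 * schurScaled c' p.2 := by
  simp only [schurScaled]
  rw [← schurEval_add]
  congr 1
  ext1 k
  rw [← add_mul, ← map_add, add_div]

theorem schurScaled_zero_left (n : ℕ) : schurScaled 0 n = if n = 0 then 1 else 0 := by
  rw [← schurEval_const_zero, schurScaled]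
  simp

theorem schurScaled_one (c : ℚ) : schurScaled c 1 = c • MvPolynomial.X 1 := by
  have := schurScaled_succ c 0
  simpa [schurScaled_zero] using this

/-! ### Restriction of double power series to the diagonal -/

section Diagonal

variable {S : Type*} [CommRing S]

/-- For a polynomial in the outer variable, restriction to the diagonal is evaluation at `X`, hence
multiplicative. Truncation transfers this to all series in `diagSeries`. -/
theorem coeff_eval_X (p : Polynomial (PowerSeries S)) (n : ℕ) :
    PowerSeries.coeff n (p.eval PowerSeries.X) =
      ∑ q ∈ antidiagonal n, PowerSeries.coeff q.2 (p.coeff q.1) := by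
  induction p using Polynomial.induction_on' with
  | add p q hp hq => simp [hp, hq, Finset.sum_add_distrib]
  | monomial k a =>
    rw [Polynomial.eval_monomial, PowerSeries.coeff_mul_X_pow']
    split_ifs with h
    · rw [Finset.sum_eq_single (k, n - k)]
      · simp
      · rintro ⟨i, j⟩ hij hne
        rw [HasAntidiagonal.mem_antidiagonal] at hij
        simp only at hij
        rw [Polynomial.coeff_monomial, if_neg, map_zero]
        rintro rfl
        exact hne (Prod.ext rfl (by simp only; omega))
      · intro h'
        exact absurd (HasAntidiagonal.mem_antidiagonal.2 (by simp; omega)) h'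
    · symm
      refine Finset.sum_eq_zero fun q hq => ?_
      have := HasAntidiagonal.mem_antidiagonal.1 hq
      rw [Polynomial.coeff_monomial, if_neg (by omega), map_zero]

/-- Restriction of a power series in two variables to the diagonal. -/
def diagSeries : PowerSeries (PowerSeries S) →+* PowerSeries S where
  toFun f := PowerSeries.mk fun n =>
    ∑ q ∈ antidiagonal n, PowerSeries.coeff q.2 (PowerSeries.coeff q.1 f)
  map_zero' := by ext; simp
  map_add' f g := by ext; simp [Finset.sum_add_distrib]
  map_one' := by
    ext n
    rw [PowerSeries.coeff_mk]
    have := coeff_eval_X (S := S) 1 n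
    rw [Polynomial.eval_one] at this
    rw [this]
    refine Finset.sum_congr rfl fun q _ => ?_
    rw [PowerSeries.coeff_one, Polynomial.coeff_one]
  map_mul' f g := by
    have key : ∀ (f : PowerSeries (PowerSeries S)) (n N : ℕ), n < N →
        ∑ q ∈ antidiagonal n, PowerSeries.coeff q.2 (PowerSeries.coeff q.1 f) =
          PowerSeries.coeff n ((PowerSeries.trunc N f).eval PowerSeries.X) := by
      intro f n N hn
      rw [coeff_eval_X]
      refine Finset.sum_congr rfl fun q hq => ?_
      have := HasAntidiagonal.mem_antidiagonal.1 hq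
      rw [PowerSeries.coeff_trunc, if_pos (by omega)]
    ext n
    rw [PowerSeries.coeff_mk, PowerSeries.coeff_mul]
    have h1 : ∑ q ∈ antidiagonal n, PowerSeries.coeff q.2 (PowerSeries.coeff q.1 (f * g)) =
        PowerSeries.coeff n
          ((PowerSeries.trunc (n + 1) f * PowerSeries.trunc (n + 1) g).eval PowerSeries.X) := by
      rw [coeff_eval_X]
      refine Finset.sum_congr rfl fun q hq => ?_
      have := HasAntidiagonal.mem_antidiagonal.1 hq
      rw [PowerSeries.coeff_mul, Polynomial.coeff_mul]
      congr 1
      refine Finset.sum_congr rfl fun r hr => ?_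
      have := HasAntidiagonal.mem_antidiagonal.1 hr
      rw [PowerSeries.coeff_trunc, if_pos (by omega), PowerSeries.coeff_trunc, if_pos (by omega)]
    rw [h1, Polynomial.eval_mul, PowerSeries.coeff_mul]
    refine Finset.sum_congr rfl fun r hr => ?_
    have := HasAntidiagonal.mem_antidiagonal.1 hr
    rw [PowerSeries.coeff_mk, PowerSeries.coeff_mk, key f r.1 (n + 1) (by omega),
      key g r.2 (n + 1) (by omega)]

theorem coeff_diagSeries (f : PowerSeries (PowerSeries S)) (n : ℕ) :
    PowerSeries.coeff n (diagSeries f) =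
      ∑ q ∈ antidiagonal n, PowerSeries.coeff q.2 (PowerSeries.coeff q.1 f) := by
  simp [diagSeries]

theorem diagSeries_C (f : PowerSeries S) : diagSeries (PowerSeries.C f) = f := by
  ext n
  rw [coeff_diagSeries, Finset.sum_eq_single (0, n)]
  · simp
  · rintro ⟨i, j⟩ hij hne
    rw [HasAntidiagonal.mem_antidiagonal] at hij
    simp only at hij
    rw [PowerSeries.coeff_C, if_neg, map_zero]
    rintro rfl
    exact hne (Prod.ext rfl (by simp only; omega))
  · simp

end Diagonal

/-! ### Constant-coefficient and bilinear operators -/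

namespace CommDerivations

variable {A : Type*} [CommRing A] [Algebra ℚ A] (D : CommDerivations A)

/-- Constant-coefficient operators. -/
def op : MvPolynomial ℕ ℚ →ₐ[ℚ] Module.End ℚ A :=
  commEval (fun n => (D.der n : A →ₗ[ℚ] A)) fun m n => LinearMap.ext fun f => D.der_comm m n f

@[simp]
theorem op_X (n : ℕ) (a : A) : D.op (MvPolynomial.X n) a = D.der n a := by
  rw [op, commEval_X]
  rfl

theorem op_mul (P Q : MvPolynomial ℕ ℚ) (a : A) : D.op (P * Q) a = D.op P (D.op Q a) := by
  rw [map_mul]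
  rfl

theorem op_one (a : A) : D.op 1 a = a := by
  rw [map_one]
  rfl

theorem op_comm (P Q : MvPolynomial ℕ ℚ) (a : A) : D.op P (D.op Q a) = D.op Q (D.op P a) := by
  rw [← op_mul, mul_comm, op_mul]

theorem op_der (P : MvPolynomial ℕ ℚ) (n : ℕ) (a : A) :
    D.op P (D.der n a) = D.der n (D.op P a) := by
  rw [← op_X, op_comm, op_X]

/-- The bilinear operators `(P ⊗ Q)(a, b) = P(∂) a * Q(∂) b`. -/
def bilin (a b : A) : MvPolynomial ℕ ℚ ⊗[ℚ] MvPolynomial ℕ ℚ →ₗ[ℚ] A :=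
  LinearMap.mul' ℚ A ∘ₗ TensorProduct.map ((LinearMap.applyₗ a) ∘ₗ D.op.toLinearMap)
    ((LinearMap.applyₗ b) ∘ₗ D.op.toLinearMap)

theorem bilin_tmul (a b : A) (P Q : MvPolynomial ℕ ℚ) :
    D.bilin a b (P ⊗ₜ Q) = D.op P a * D.op Q b := rfl

end CommDerivations

/-- The coproduct `y_i ↦ y_i ⊗ 1 + 1 ⊗ y_i`. -/
def polyCoprod : MvPolynomial ℕ ℚ →ₐ[ℚ] MvPolynomial ℕ ℚ ⊗[ℚ] MvPolynomial ℕ ℚ :=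
  MvPolynomial.aeval fun i => MvPolynomial.X i ⊗ₜ 1 + 1 ⊗ₜ MvPolynomial.X i

/-- The generating series is the exponential of primitive elements, hence group-like. -/
theorem polyCoprod_schurScaled (c : ℚ) (n : ℕ) :
    polyCoprod (schurScaled c n) =
      ∑ p ∈ antidiagonal n, schurScaled c p.1 ⊗ₜ schurScaled c p.2 := by
  rw [schurScaled, map_schurEval]
  have h : ∀ k : ℕ, polyCoprod (MvPolynomial.C (c / (k : ℚ)) * MvPolynomial.X k) =
      (Algebra.TensorProduct.includeLeft (R := ℚ) (S := ℚ) (A := MvPolynomial ℕ ℚ)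
          (B := MvPolynomial ℕ ℚ)) (MvPolynomial.C (c / (k : ℚ)) * MvPolynomial.X k) +
        (Algebra.TensorProduct.includeRight (R := ℚ) (A := MvPolynomial ℕ ℚ)
          (B := MvPolynomial ℕ ℚ)) (MvPolynomial.C (c / (k : ℚ)) * MvPolynomial.X k) := by
    intro k
    simp only [← MvPolynomial.smul_eq_C_mul, map_smul, polyCoprod, MvPolynomial.aeval_X]
    rw [smul_add]
    rfl
  simp_rw [h]
  rw [schurEval_add]
  refine Finset.sum_congr rfl fun p _ => ?_
  rw [← map_schurEval, ← map_schurEval]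
  simp only [Algebra.TensorProduct.includeLeft_apply, Algebra.TensorProduct.includeRight_apply,
    Algebra.TensorProduct.tmul_mul_tmul, mul_one, one_mul]
  rfl

namespace CommDerivations

variable {A : Type*} [CommRing A] [Algebra ℚ A] (D : CommDerivations A)

theorem bilin_X_add_X_mul (a b : A) (i : ℕ) (t : MvPolynomial ℕ ℚ ⊗[ℚ] MvPolynomial ℕ ℚ) :
    D.bilin a b ((MvPolynomial.X i ⊗ₜ 1 + 1 ⊗ₜ MvPolynomial.X i) * t) =
      D.der i (D.bilin a b t) := by
  induction t with
  | zero => simp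
  | add t t' h h' => rw [mul_add, map_add, map_add, map_add, h, h']
  | tmul P Q =>
    rw [add_mul, Algebra.TensorProduct.tmul_mul_tmul, Algebra.TensorProduct.tmul_mul_tmul,
      one_mul, one_mul, map_add, bilin_tmul, bilin_tmul, bilin_tmul, op_mul, op_mul, op_X, op_X,
      Derivation.leibniz, smul_eq_mul, smul_eq_mul]
    ring

/-- The Leibniz rule for all constant-coefficient operators. It makes a factor in the image of the
coproduct harmless for the vanishing of a bilinear expression. -/
theorem bilin_polyCoprod_mul (a b : A) (Q : MvPolynomial ℕ ℚ)
    (t : MvPolynomial ℕ ℚ ⊗[ℚ] MvPolynomial ℕ ℚ) :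
    D.bilin a b (polyCoprod Q * t) = D.op Q (D.bilin a b t) := by
  induction Q using MvPolynomial.induction_on generalizing t with
  | C r =>
    rw [← MvPolynomial.algebraMap_eq, AlgHom.commutes, AlgHom.commutes, ← Algebra.smul_def,
      map_smul]
    rfl
  | add P Q hP hQ => rw [map_add, add_mul, map_add, hP, hQ, map_add]; rfl
  | mul_X P i hP =>
    rw [map_mul polyCoprod, mul_assoc, hP, op_mul, op_X, ← bilin_X_add_X_mul]
    congr 3
    exact MvPolynomial.aeval_X _ _

/-! ### The shifts a ↦ a(t + c[z]) -/

/-- The operators `p_n(c ∂̃)`. -/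
abbrev sop (c : ℚ) (n : ℕ) : Module.End ℚ A := D.op (schurScaled c n)

theorem sop_zero (c : ℚ) (a : A) : D.sop c 0 a = a := by
  rw [sop, schurScaled_zero, op_one]

theorem sop_one (c : ℚ) (a : A) : D.sop c 1 a = c • D.der 1 a := by
  rw [sop, schurScaled_one, map_smul, LinearMap.smul_apply, op_X]

theorem sop_succ (c : ℚ) (n : ℕ) (a : A) :
    ((n + 1 : ℕ) : ℚ) • D.sop c (n + 1) a =
      c • ∑ p ∈ antidiagonal n, D.der (p.1 + 1) (D.sop c p.2 a) := by
  have := congrArg (fun P => D.op P a) (schurScaled_succ c n)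
  simpa only [map_smul, map_sum, LinearMap.smul_apply, LinearMap.sum_apply, op_mul, op_X] using this

theorem sop_mul (c : ℚ) (n : ℕ) (a b : A) :
    D.sop c n (a * b) = ∑ p ∈ antidiagonal n, D.sop c p.1 a * D.sop c p.2 b := by
  have h := D.bilin_polyCoprod_mul a b (schurScaled c n) 1
  rw [mul_one, polyCoprod_schurScaled, map_sum, Algebra.TensorProduct.one_def, bilin_tmul, op_one,
    op_one] at h
  rw [sop, ← h]
  rfl

theorem sop_add (c c' : ℚ) (n : ℕ) (a : A) :
    D.sop (c + c') n a = ∑ p ∈ antidiagonal n, D.sop c p.1 (D.sop c' p.2 a) := by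
  rw [sop, schurScaled_add, map_sum, LinearMap.sum_apply]
  simp only [op_mul]

theorem sop_const_one (c : ℚ) (n : ℕ) : D.sop c n 1 = if n = 0 then 1 else 0 := by
  induction n using Nat.strong_induction_on with
  | _ n ih =>
    rcases n with _ | n
    · rw [sop_zero, if_pos rfl]
    · have h := D.sop_succ c n 1
      rw [Finset.sum_eq_zero, smul_zero] at h
      · rw [if_neg (Nat.succ_ne_zero n)]
        exact (smul_eq_zero_iff_right (by positivity)).1 h
      · intro p hp
        have := HasAntidiagonal.mem_antidiagonal.1 hp
        rw [ih p.2 (by omega)]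
        split_ifs <;> simp

/-- The shift `a ↦ exp (c ∑ z ^ k ∂_k / k) a`. -/
def shift (c : ℚ) : A →ₐ[ℚ] PowerSeries A where
  toFun a := PowerSeries.mk fun n => D.sop c n a
  map_zero' := by ext; simp
  map_add' a b := by ext; simp
  map_one' := by
    ext n
    rw [PowerSeries.coeff_mk, sop_const_one, PowerSeries.coeff_one]
  map_mul' a b := by
    ext n
    rw [PowerSeries.coeff_mk, PowerSeries.coeff_mul, sop_mul]
    simp only [PowerSeries.coeff_mk]
  commutes' r := by
    ext n
    rw [PowerSeries.coeff_mk, Algebra.algebraMap_eq_smul_one, Algebra.algebraMap_eq_smul_one,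
      map_smul, sop_const_one, PowerSeries.coeff_smul, PowerSeries.coeff_one]

theorem coeff_shift (c : ℚ) (n : ℕ) (a : A) : PowerSeries.coeff n (D.shift c a) = D.sop c n a := by
  simp [shift]

theorem constantCoeff_shift (c : ℚ) (a : A) : PowerSeries.constantCoeff (D.shift c a) = a := by
  rw [← PowerSeries.coeff_zero_eq_constantCoeff_apply, coeff_shift, sop_zero]

/-- The shift of a power series whose variable is the shift parameter. -/
def hshift (c : ℚ) : PowerSeries A →+* PowerSeries A :=
  diagSeries.comp (PowerSeries.map (D.shift c : A →+* PowerSeries A))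

theorem coeff_hshift (c : ℚ) (n : ℕ) (f : PowerSeries A) :
    PowerSeries.coeff n (D.hshift c f) =
      ∑ q ∈ antidiagonal n, D.sop c q.2 (PowerSeries.coeff q.1 f) := by
  rw [hshift, RingHom.comp_apply, coeff_diagSeries]
  refine Finset.sum_congr rfl fun q _ => ?_
  rw [PowerSeries.coeff_map]
  exact D.coeff_shift _ _ _

theorem hshift_C (c : ℚ) (a : A) : D.hshift c (PowerSeries.C a) = D.shift c a := by
  rw [hshift, RingHom.comp_apply, PowerSeries.map_C, diagSeries_C]
  rfl

theorem hshift_X (c : ℚ) : D.hshift c PowerSeries.X = PowerSeries.X := by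
  rw [hshift, RingHom.comp_apply, PowerSeries.map_X]
  ext n
  rw [coeff_diagSeries]
  have := coeff_eval_X (S := A) Polynomial.X n
  rw [Polynomial.eval_X] at this
  rw [this]
  refine Finset.sum_congr rfl fun q _ => ?_
  rw [PowerSeries.coeff_X, Polynomial.coeff_X]
  simp only [eq_comm]

theorem hshift_shift (c c' : ℚ) (a : A) : D.hshift c (D.shift c' a) = D.shift (c + c') a := by
  ext n
  rw [coeff_hshift, coeff_shift, sop_add, ← Finset.Nat.sum_antidiagonal_swap]
  simp only [coeff_shift, Prod.fst_swap, Prod.snd_swap]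

theorem shift_zero_left (a : A) : D.shift 0 a = PowerSeries.C a := by
  ext n
  rw [coeff_shift, sop, schurScaled_zero_left, PowerSeries.coeff_C]
  split_ifs
  · rw [op_one]
  · simp

/-- The generating series `∑ z ^ i ∂_{i + 1} a`. -/
def gen (a : A) : PowerSeries A := PowerSeries.mk fun i => D.der (i + 1) a

/-- The chain rule: the z-derivative of z^k / k is z^(k - 1). -/
theorem derivative_shift (c : ℚ) (a : A) :
    PowerSeries.derivative A (D.shift c a) = c • D.hshift c (D.gen a) := by
  ext n
  rw [PowerSeries.coeff_derivative, coeff_shift, PowerSeries.coeff_smul, coeff_hshift]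
  have h := D.sop_succ c n a
  rw [Algebra.smul_def, map_natCast] at h
  push_cast at h
  rw [mul_comm, h]
  congr 1
  refine Finset.sum_congr rfl fun p _ => ?_
  rw [gen, PowerSeries.coeff_mk, op_der]

end CommDerivations

/-! ### Extension of the derivations to power series -/

/-- The coefficientwise extension of a derivation to power series. -/
def Derivation.liftPowerSeries {A : Type*} [CommRing A] [Algebra ℚ A] (δ : Derivation ℚ A A) :
    Derivation ℚ (PowerSeries A) (PowerSeries A) :=
  Derivation.mk'
    { toFun := fun f => PowerSeries.mk fun n => δ (PowerSeries.coeff n f)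
      map_add' := fun f g => by ext; simp
      map_smul' := fun r f => by ext; simp }
    fun f g => by
      ext n
      simp only [LinearMap.coe_mk, AddHom.coe_mk, PowerSeries.coeff_mk, map_add, smul_eq_mul,
        PowerSeries.coeff_mul, map_sum, Derivation.leibniz, Finset.sum_add_distrib]
      rw [← Finset.Nat.sum_antidiagonal_swap (f := fun p =>
        PowerSeries.coeff p.1 g * δ (PowerSeries.coeff p.2 f))]
      rfl

@[simp]
theorem Derivation.coeff_liftPowerSeries {A : Type*} [CommRing A] [Algebra ℚ A]
    (δ : Derivation ℚ A A) (n : ℕ) (f : PowerSeries A) :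
    PowerSeries.coeff n (δ.liftPowerSeries f) = δ (PowerSeries.coeff n f) := by
  simp [Derivation.liftPowerSeries]

namespace CommDerivations

variable {A : Type*} [CommRing A] [Algebra ℚ A] (D : CommDerivations A)

/-- The coefficientwise extension of commuting derivations to power series. -/
def lift : CommDerivations (PowerSeries A) where
  der n := (D.der n).liftPowerSeries
  der_zero := by ext; simp [D.der_zero]
  der_comm m n f := by ext; simp [D.der_comm m n]

@[simp]
theorem coeff_lift_der (i n : ℕ) (f : PowerSeries A) :
    PowerSeries.coeff n (D.lift.der i f) = D.der i (PowerSeries.coeff n f) :=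
  Derivation.coeff_liftPowerSeries _ _ _

theorem coeff_lift_op (P : MvPolynomial ℕ ℚ) (n : ℕ) (f : PowerSeries A) :
    PowerSeries.coeff n (D.lift.op P f) = D.op P (PowerSeries.coeff n f) := by
  induction P using MvPolynomial.induction_on generalizing f with
  | C r =>
    rw [← MvPolynomial.algebraMap_eq, AlgHom.commutes, AlgHom.commutes]
    simp [Module.algebraMap_end_apply]
  | add P Q hP hQ => simp [hP, hQ]
  | mul_X P i hP => rw [op_mul, op_mul, hP, op_X, op_X, coeff_lift_der]

theorem lift_op_C (P : MvPolynomial ℕ ℚ) (a : A) :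
    D.lift.op P (PowerSeries.C a) = PowerSeries.C (D.op P a) := by
  ext n
  rw [coeff_lift_op, PowerSeries.coeff_C, PowerSeries.coeff_C]
  split_ifs <;> simp

theorem lift_der_C (n : ℕ) (a : A) :
    D.lift.der n (PowerSeries.C a) = PowerSeries.C (D.der n a) := by
  rw [← op_X, lift_op_C, op_X]

theorem lift_der_X (n : ℕ) : D.lift.der n PowerSeries.X = 0 := by
  ext k
  rw [coeff_lift_der, PowerSeries.coeff_X]
  split_ifs <;> simp

theorem lift_op_shift (P : MvPolynomial ℕ ℚ) (c : ℚ) (a : A) :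
    D.lift.op P (D.shift c a) = D.shift c (D.op P a) := by
  ext n
  rw [coeff_lift_op, coeff_shift, coeff_shift, op_comm]

theorem lift_der_shift (n : ℕ) (c : ℚ) (a : A) :
    D.lift.der n (D.shift c a) = D.shift c (D.der n a) := by
  rw [← op_X, lift_op_shift, op_X]

theorem diagSeries_shift (c : ℚ) (f : PowerSeries A) :
    diagSeries (D.lift.shift c f) = D.hshift c f := by
  ext n
  rw [coeff_diagSeries, coeff_hshift, ← Finset.Nat.sum_antidiagonal_swap]
  refine Finset.sum_congr rfl fun q _ => ?_
  rw [coeff_shift, coeff_lift_op]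
  rfl

theorem map_shift_shift (c c' : ℚ) (a : A) :
    PowerSeries.map (D.shift c : A →+* PowerSeries A) (D.shift c' a) =
      D.lift.shift c' (D.shift c a) := by
  ext m n
  rw [PowerSeries.coeff_map, coeff_shift, coeff_shift, lift_op_shift]
  rfl

/-! ### Logarithms and the series of the Z_j -/

variable {D} {τ F : A}

/-- `F` is a logarithm of `τ`. -/
def IsLog (D : CommDerivations A) (τ F : A) : Prop := ∀ n, D.der n τ = τ * D.der n F

theorem IsLog.derivative_shift (h : D.IsLog τ F) (c : ℚ) :
    PowerSeries.derivative A (D.shift c τ) =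
      D.shift c τ * PowerSeries.derivative A (D.shift c F) := by
  have : D.gen τ = PowerSeries.C τ * D.gen F := by
    ext n
    simp [gen, h (n + 1)]
  rw [CommDerivations.derivative_shift, CommDerivations.derivative_shift, this, map_mul, hshift_C,
    mul_smul_comm]

/-- The series `∑ Z_j z ^ j` with `Z_j = ∑_{k + m = j} p_k(-∂̃) p_m(-∂̃) F`, `k, m ≥ 1`. -/
def zSeries (D : CommDerivations A) (F : A) : PowerSeries A :=
  D.shift (-2) F - 2 * D.shift (-1) F + PowerSeries.C F

/-- Formally exp(F(t - 2[z]) - 2F(t - [z]) + F) = τ(t - 2[z]) τ / τ(t - [z])². Since exp F need not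
exist in A, the two sides are compared through their logarithmic z-derivatives and constant terms.
-/
theorem IsLog.schurSeries_zSeries (h : D.IsLog τ F) :
    schurSeries (fun j => PowerSeries.coeff j (D.zSeries F)) * D.shift (-1) τ ^ 2 =
      D.shift (-2) τ * PowerSeries.C τ := by
  have hz : PowerSeries.derivative A (D.zSeries F) =
      PowerSeries.derivative A (D.shift (-2) F) -
        2 * PowerSeries.derivative A (D.shift (-1) F) := by
    rw [zSeries, map_add, map_sub, PowerSeries.derivative_C, add_zero, two_mul, two_mul, map_add]
  refine eq_of_derivative_eq_mul (g := PowerSeries.derivative A (D.shift (-2) F)) ?_ ?_ ?_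
  · have hs : PowerSeries.mk (fun i => ((i + 1 : ℕ) : A) * PowerSeries.coeff (i + 1) (D.zSeries F))
        = PowerSeries.derivative A (D.zSeries F) := by
      ext n
      rw [PowerSeries.coeff_mk, PowerSeries.coeff_derivative]
      push_cast
      ring
    rw [Derivation.leibniz, Derivation.leibniz_pow, derivative_schurSeries, hs,
      h.derivative_shift, hz]
    simp only [smul_eq_mul, nsmul_eq_mul, Nat.cast_ofNat]
    ring
  · rw [Derivation.leibniz, PowerSeries.derivative_C, h.derivative_shift]
    simp only [smul_eq_mul]
    ring
  · rw [map_mul, map_mul, map_pow, constantCoeff_schurSeries, constantCoeff_shift,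
      constantCoeff_shift, PowerSeries.constantCoeff_C]
    ring

/-- Shifting by -[z] twice is shifting by -2[z]. Subtracting 2F(t - [z]) and adding F removes
exactly the terms with k = 0 or m = 0. -/
theorem coeff_zSeries (F : A) (j : ℕ) :
    PowerSeries.coeff j (D.zSeries F) =
      ∑ p ∈ antidiagonal j with 1 ≤ p.1 ∧ 1 ≤ p.2, D.sop (-1) p.1 (D.sop (-1) p.2 F) := by
  have h2 : PowerSeries.coeff j (D.shift (-2) F) =
      ∑ p ∈ antidiagonal j, D.sop (-1) p.1 (D.sop (-1) p.2 F) := by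
    rw [coeff_shift, ← sop_add]
    norm_num
  have h1 : PowerSeries.coeff j (2 * D.shift (-1) F) = 2 * D.sop (-1) j F := by
    rw [two_mul, map_add, coeff_shift, two_mul]
  rw [zSeries, map_add, map_sub, h1, h2, PowerSeries.coeff_C]
  rcases j with _ | j
  · simp [sop_zero, Finset.sum_filter]
    ring
  · rw [Finset.sum_filter, Finset.Nat.sum_antidiagonal_succ, Finset.Nat.sum_antidiagonal_succ]
    rcases j with _ | j
    · simp [sop_zero]
      ring
    · rw [Finset.Nat.sum_antidiagonal_succ', Finset.Nat.sum_antidiagonal_succ']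
      simp [sop_zero]
      ring

end CommDerivations

/-! ### Passage from the operators of the statement to `CommDerivations` -/

section Translation

variable {A : Type*} [CommRing A] [Algebra ℚ A]

/-- Commuting derivations `d 1, d 2, …` as a `CommDerivations`. -/
def CommDerivations.mk' (d : ℕ → Derivation ℚ A A)
    (hcomm : ∀ m n, 1 ≤ m → 1 ≤ n → ∀ f, d m (d n f) = d n (d m f)) : CommDerivations A where
  der n := if n = 0 then 0 else d n
  der_zero := if_pos rfl
  der_comm m n f := by
    split_ifs with hm hn hn
    · rfl
    · simp
    · simp
    · exact hcomm m n (Nat.pos_of_ne_zero hm) (Nat.pos_of_ne_zero hn) f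

variable {d : ℕ → Derivation ℚ A A}
  {hcomm : ∀ m n, 1 ≤ m → 1 ≤ n → ∀ f, d m (d n f) = d n (d m f)}

theorem CommDerivations.mk'_der {n : ℕ} (hn : 1 ≤ n) :
    (CommDerivations.mk' d hcomm).der n = d n := if_neg (by omega)

theorem monomialOp_eq {s : ℕ →₀ ℕ} (hs : s 0 = 0) :
    monomialOp d s = (CommDerivations.mk' d hcomm).op (MvPolynomial.monomial s 1) := by
  have h : (MvPolynomial.monomial s 1 : MvPolynomial ℕ ℚ) =
      ((s.support.sort (· ≤ ·)).map fun i => MvPolynomial.X i ^ s i).prod := by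
    rw [MvPolynomial.monomial_eq, map_one, one_mul, Finsupp.prod, ← List.prod_toFinset _
      (Finset.sort_nodup _ _), Finset.sort_toFinset]
  rw [h, map_list_prod, List.map_map, monomialOp]
  congr 1
  refine List.map_congr_left fun i hi => ?_
  have hi0 : 1 ≤ i := by
    rcases Nat.eq_zero_or_pos i with rfl | h
    · rw [Finset.mem_sort, Finsupp.mem_support_iff] at hi
      exact absurd hs hi
    · exact h
  rw [Function.comp_apply, map_pow]
  congr 1
  ext a
  rw [CommDerivations.op_X, CommDerivations.mk'_der hi0]
  rfl

theorem polyOp_eq {P : MvPolynomial ℕ ℚ} (hP : ∀ s ∈ P.support, s 0 = 0) :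
    polyOp d P = (CommDerivations.mk' d hcomm).op P := by
  conv_rhs => rw [P.as_sum]
  rw [map_sum, polyOp]
  refine Finset.sum_congr rfl fun s hs => ?_
  rw [monomialOp_eq (hcomm := hcomm) (hP s hs), ← map_smul, MvPolynomial.smul_monomial,
    smul_eq_mul, mul_one]

theorem schurScaled_mem_supported (c : ℚ) (n : ℕ) :
    schurScaled c n ∈ MvPolynomial.supported ℚ ({0}ᶜ : Set ℕ) := by
  have : ∀ k : ℕ, MvPolynomial.C (c / (k : ℚ)) * MvPolynomial.X k ∈
      MvPolynomial.supported ℚ ({0}ᶜ : Set ℕ) := by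
    intro k
    rcases Nat.eq_zero_or_pos k with rfl | hk
    · simp
    · refine Subalgebra.mul_mem _ (Subalgebra.algebraMap_mem _ _) ?_
      exact MvPolynomial.X_mem_supported.2 (by simp; omega)
  have h := map_schurEval (MvPolynomial.supported ℚ ({0}ᶜ : Set ℕ)).val n fun k => ⟨_, this k⟩
  rw [schurScaled]
  exact h ▸ Subtype.coe_prop _

theorem support_zero_of_mem_supported {P : MvPolynomial ℕ ℚ}
    (h : P ∈ MvPolynomial.supported ℚ ({0}ᶜ : Set ℕ)) : ∀ s ∈ P.support, s 0 = 0 := by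
  intro s hs
  by_contra h0
  have : 0 ∈ P.vars := (MvPolynomial.mem_vars_iff_mem_support 0).2
    ⟨s, hs, Finsupp.mem_support_iff.2 h0⟩
  exact (MvPolynomial.mem_supported.1 h this) rfl

theorem schurOp_eq (n : ℕ) :
    schurOp d n = (CommDerivations.mk' d hcomm).sop (-1) n := by
  have : schurNegTilde n = schurScaled (-1) n := by
    rw [schurNegTilde, schurScaled]
    congr 1
    ext1 k
    rw [← neg_mul, ← map_neg, neg_div]
  rw [schurOp, this, polyOp_eq (support_zero_of_mem_supported (schurScaled_mem_supported _ _))]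

theorem zSum_eq (f : A) (j : ℕ) :
    zSum d f j = PowerSeries.coeff j ((CommDerivations.mk' d hcomm).zSeries f) := by
  rw [CommDerivations.coeff_zSeries, zSum]
  simp only [schurOp_eq (hcomm := hcomm)]

theorem rSum_succ (f : A) (n : ℕ) :
    rSum d f (n + 2) =
      ∑ p ∈ antidiagonal n, (CommDerivations.mk' d hcomm).sop (-1) p.2
        ((CommDerivations.mk' d hcomm).der (p.1 + 1) f) := by
  rw [rSum, Finset.sum_filter, show n + 2 - 1 = n + 1 from rfl, Finset.Nat.sum_antidiagonal_succ]
  simp only [schurOp_eq (hcomm := hcomm)]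
  rw [if_neg (by omega), zero_add]
  refine Finset.sum_congr rfl fun p _ => ?_
  rw [if_pos (by omega), CommDerivations.mk'_der (by omega)]

/-- The equations (*) assembled into one series identity. The coefficients 0 and 1, absent from (*),
agree automatically: p_0 = 1, and p_1(Z) = Z_1 is an empty sum. -/
theorem logTauEquations_iff (F : A) :
    LogTauEquations d F ↔
      schurSeries (fun j => PowerSeries.coeff j ((CommDerivations.mk' d hcomm).zSeries F)) =
        1 + PowerSeries.X * (PowerSeries.X * (CommDerivations.mk' d hcomm).hshift (-1)
          ((CommDerivations.mk' d hcomm).gen ((CommDerivations.mk' d hcomm).der 1 F))) := by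
  set D := CommDerivations.mk' d hcomm with hD
  have hz : zSum d F = fun j => PowerSeries.coeff j (D.zSeries F) :=
    funext fun j => zSum_eq (hcomm := hcomm) F j
  have h1 : d 1 F = D.der 1 F := by rw [hD, CommDerivations.mk'_der le_rfl]
  have hr : ∀ n, rSum d (d 1 F) (n + 2) =
      PowerSeries.coeff n (D.hshift (-1) (D.gen (D.der 1 F))) := by
    intro n
    rw [rSum_succ (hcomm := hcomm), CommDerivations.coeff_hshift, h1]
    refine Finset.sum_congr rfl fun p _ => ?_
    rw [CommDerivations.gen, PowerSeries.coeff_mk]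
  constructor
  · intro h
    ext i
    rw [coeff_schurSeries, map_add]
    rcases i with _ | _ | n
    · simp [schurEval_zero]
    · have := schurEval_succ 0 fun j => PowerSeries.coeff j (D.zSeries F)
      rw [PowerSeries.coeff_succ_X_mul, PowerSeries.coeff_zero_X_mul, PowerSeries.coeff_one]
      simp only [zero_add, Nat.cast_one, one_mul, Finset.Nat.antidiagonal_zero,
        Finset.sum_singleton, schurEval_zero, mul_one] at this
      rw [this, CommDerivations.coeff_zSeries, Finset.sum_filter,
        Finset.Nat.sum_antidiagonal_succ]
      simp
    · rw [PowerSeries.coeff_succ_X_mul, PowerSeries.coeff_succ_X_mul, PowerSeries.coeff_one, ← hr,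
        ← h (n + 2) (by omega), hz]
      simp
  · intro h i hi
    obtain ⟨n, rfl⟩ : ∃ n, i = n + 2 := ⟨i - 2, by omega⟩
    rw [hr, hz, ← coeff_schurSeries, h, map_add, PowerSeries.coeff_succ_X_mul,
      PowerSeries.coeff_succ_X_mul, PowerSeries.coeff_one]
    simp

end Translation

/-! ### Exponentials in infinitely many variables -/

section MvExp

variable {S : Type*} [CommRing S] [Algebra ℚ S]

/-- The exponential `exp (∑ v_i s_i)` as a power series in `s_0, s_1, …`. -/
def mvExp (v : ℕ → S) : MvPowerSeries ℕ S := fun s =>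
  (1 / (multiFactorial s : ℚ)) • s.prod fun i k => v i ^ k

theorem coeff_mvExp (v : ℕ → S) (s : ℕ →₀ ℕ) :
    MvPowerSeries.coeff s (mvExp v) = (1 / (multiFactorial s : ℚ)) • s.prod fun i k => v i ^ k :=
  rfl

theorem pderiv_mvExp (v : ℕ → S) (i : ℕ) :
    MvPowerSeries.pderiv S i (mvExp v) = MvPowerSeries.C (v i) * mvExp v := by
  ext s
  rw [MvPowerSeries.coeff_pderiv, MvPowerSeries.coeff_C_mul, coeff_mvExp, coeff_mvExp,
    multiFactorial_add_single,
    Finsupp.prod_add_index' (by simp) (by intros; rw [pow_add]),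
    Finsupp.prod_single_index (by simp), pow_one]
  have h : ((s i + 1 : ℕ) : S) = algebraMap ℚ S (s i + 1 : ℕ) := by simp
  have h1 : (multiFactorial s : ℚ) ≠ 0 := by exact_mod_cast multiFactorial_ne_zero s
  have h2 : ((s i + 1 : ℕ) : ℚ) ≠ 0 := by positivity
  have h3 : ((s i : S) + 1) = algebraMap ℚ S (s i + 1 : ℕ) := by simp
  rw [h3, mul_comm, ← Algebra.smul_def, smul_smul, mul_smul_comm, mul_comm (v i)]
  congr 1
  push_cast at h2 ⊢
  field_simp

/-- A power series is determined by its logarithmic derivatives and its constant coefficient. -/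
theorem MvPowerSeries.eq_of_pderiv_eq_mul {v : ℕ → S} {f g : MvPowerSeries ℕ S}
    (hf : ∀ i, MvPowerSeries.pderiv S i f = MvPowerSeries.C (v i) * f)
    (hg : ∀ i, MvPowerSeries.pderiv S i g = MvPowerSeries.C (v i) * g)
    (h0 : MvPowerSeries.coeff 0 f = MvPowerSeries.coeff 0 g) : f = g := by
  ext s
  induction hn : s.degree using Nat.strong_induction_on generalizing s with
  | _ n ih =>
    by_cases hs : s = 0
    · rw [hs, h0]
    · obtain ⟨i, hi⟩ := Finsupp.ne_iff.1 hs
      obtain ⟨t, rfl⟩ := exists_add_single_of_ne_zero hi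
      have h1 := congrArg (MvPowerSeries.coeff t) (hf i)
      have h2 := congrArg (MvPowerSeries.coeff t) (hg i)
      rw [MvPowerSeries.coeff_pderiv, MvPowerSeries.coeff_C_mul] at h1 h2
      have hd : t.degree < n := by
        rw [← hn, map_add, Finsupp.degree_single]
        omega
      rw [ih _ hd t rfl, ← h2] at h1
      apply natCast_succ_mul_cancel (t i)
      push_cast
      rw [mul_comm, h1, mul_comm]

theorem mvExp_add (v w : ℕ → S) : mvExp (v + w) = mvExp v * mvExp w := by
  refine MvPowerSeries.eq_of_pderiv_eq_mul (pderiv_mvExp (v + w)) (fun i => ?_) ?_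
  · rw [Derivation.leibniz, pderiv_mvExp, pderiv_mvExp, Pi.add_apply, map_add]
    simp only [smul_eq_mul]
    ring
  · rw [MvPowerSeries.coeff_mul]
    simp [coeff_mvExp, multiFactorial]

theorem map_coeff_mvExp {S' : Type*} [CommRing S'] [Algebra ℚ S'] (g : S →ₐ[ℚ] S') (v : ℕ → S)
    (s : ℕ →₀ ℕ) :
    g (MvPowerSeries.coeff s (mvExp v)) = MvPowerSeries.coeff s (mvExp fun i => g (v i)) := by
  rw [coeff_mvExp, coeff_mvExp, map_smul, Finsupp.prod, Finsupp.prod, map_prod]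
  simp only [map_pow]

theorem coeff_mvExp_smul (c : ℚ) (v : ℕ → S) (s : ℕ →₀ ℕ) :
    MvPowerSeries.coeff s (mvExp (c • v)) = c ^ s.degree • MvPowerSeries.coeff s (mvExp v) := by
  rw [coeff_mvExp, coeff_mvExp, smul_comm]
  congr 1
  simp only [Pi.smul_apply, smul_pow]
  rw [Finsupp.prod, Finsupp.prod, Finset.prod_smul, Finset.prod_pow_eq_pow_sum]
  rfl

theorem aeval_monomial_eq_mvExp (v : ℕ → S) (s : ℕ →₀ ℕ) :
    MvPolynomial.aeval v (MvPolynomial.monomial s (1 / (multiFactorial s : ℚ))) =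
      MvPowerSeries.coeff s (mvExp v) := by
  rw [MvPolynomial.aeval_monomial, coeff_mvExp, Algebra.smul_def]

end MvExp

theorem coeff_aeval_smul_X (c : ℚ) (P : MvPolynomial ℕ ℚ) (s : ℕ →₀ ℕ) :
    MvPolynomial.coeff s (MvPolynomial.aeval
      (fun k => c • (MvPolynomial.X k : MvPolynomial ℕ ℚ)) P) =
      c ^ s.degree * MvPolynomial.coeff s P := by
  classical
  induction P using MvPolynomial.induction_on' with
  | add P Q hP hQ => rw [map_add, MvPolynomial.coeff_add, MvPolynomial.coeff_add, hP, hQ, mul_add]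
  | monomial t a =>
    have : MvPolynomial.aeval (fun k => c • (MvPolynomial.X k : MvPolynomial ℕ ℚ))
        (MvPolynomial.monomial t a) = c ^ t.degree • MvPolynomial.monomial t a := by
      rw [MvPolynomial.aeval_monomial, MvPolynomial.monomial_eq (s := t) (a := a),
        MvPolynomial.algebraMap_eq]
      simp only [smul_pow]
      rw [Finsupp.prod, Finset.prod_smul, Finset.prod_pow_eq_pow_sum, mul_smul_comm]
      rfl
    rw [this, MvPolynomial.coeff_smul, MvPolynomial.coeff_monomial, smul_eq_mul]
    split_ifs with h
    · rw [h]
    · simp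

theorem coeff_schurEval_neg_two_mul (n : ℕ) (s : ℕ →₀ ℕ) :
    MvPolynomial.coeff s (schurEval n fun k => -2 * (MvPolynomial.X k : MvPolynomial ℕ ℚ)) =
      if s 0 = 0 ∧ multiWeight s = n then (-2) ^ s.degree / (multiFactorial s : ℚ) else 0 := by
  have : (fun k => -2 * (MvPolynomial.X k : MvPolynomial ℕ ℚ)) =
      fun k => (-2 : ℚ) • (MvPolynomial.X k : MvPolynomial ℕ ℚ) := by
    ext1 k
    rw [MvPolynomial.smul_eq_C_mul, map_neg, map_ofNat]
  rw [this, schurEval, coeff_aeval_smul_X, coeff_schurPoly]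
  split_ifs <;> simp [div_eq_mul_inv]

theorem schurTilde_eq (n : ℕ) : schurTilde n = schurScaled 1 n := rfl

theorem add_apply_zero_of_mem_antidiagonal {s : ℕ →₀ ℕ} {p : (ℕ →₀ ℕ) × (ℕ →₀ ℕ)}
    (hp : p ∈ antidiagonal s) (i : ℕ) : p.1 i + p.2 i = s i := by
  rw [← HasAntidiagonal.mem_antidiagonal.1 hp, Finsupp.add_apply]

/-- By homogeneity of p_n(-2y), only n equal to the weight of the first multi-index contributes. -/
theorem kpHirotaPoly_eq {s : ℕ →₀ ℕ} (hs : s 0 = 0) :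
    kpHirotaPoly s = ∑ p ∈ antidiagonal s,
      ((-2) ^ p.1.degree / (multiFactorial p.1 : ℚ)) • (schurScaled 1 (multiWeight p.1 + 1) *
        MvPolynomial.monomial p.2 (1 / (multiFactorial p.2 : ℚ))) := by
  rw [kpHirotaPoly, Finset.sum_comm]
  refine Finset.sum_congr rfl fun p hp => ?_
  have h0 := add_apply_zero_of_mem_antidiagonal hp 0
  have hw : multiWeight p.1 ≤ multiWeight s := by
    rw [← HasAntidiagonal.mem_antidiagonal.1 hp, multiWeight_add]
    omega
  rw [Finset.sum_eq_single (multiWeight p.1)]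
  · rw [coeff_schurEval_neg_two_mul, if_pos ⟨by omega, rfl⟩, schurTilde_eq, mul_assoc,
      ← MvPolynomial.smul_eq_C_mul]
    congr 3
    simp [multiFactorial, Finsupp.prod]
  · intro n _ hn
    rw [coeff_schurEval_neg_two_mul, if_neg fun h => hn h.2.symm]
    simp
  · intro h
    exact absurd (Finset.mem_range.2 (by omega)) h

theorem kpHirotaPoly_support {s : ℕ →₀ ℕ} (hs : s 0 = 0) :
    ∀ t ∈ (kpHirotaPoly s).support, t 0 = 0 := by
  refine support_zero_of_mem_supported ?_
  rw [kpHirotaPoly_eq hs]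
  refine Subalgebra.sum_mem _ fun p hp => Subalgebra.smul_mem _ (Subalgebra.mul_mem _
    (schurScaled_mem_supported _ _) ?_) _
  have h0 := add_apply_zero_of_mem_antidiagonal hp 0
  rw [MvPolynomial.mem_supported]
  intro i hi
  obtain ⟨d, hd, hid⟩ := (MvPolynomial.mem_vars_iff_mem_support i).1 (Finset.mem_coe.1 hi)
  have := Finset.mem_singleton.1 (MvPolynomial.support_monomial_subset hd)
  subst this
  rintro rfl
  rw [Finsupp.mem_support_iff] at hid
  omega

/-! ### The Hirota generating function as a residue -/

/-- Polynomials in two sequences of variables, one for each factor of a bilinear expression. -/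
abbrev PolyPair := MvPolynomial ℕ ℚ ⊗[ℚ] MvPolynomial ℕ ℚ

/-- The variables for the first factor. -/
def varL (i : ℕ) : PolyPair := MvPolynomial.X i ⊗ₜ 1

/-- The variables for the second factor. -/
def varR (i : ℕ) : PolyPair := 1 ⊗ₜ MvPolynomial.X i

/-- The substitution `D_i = ∂_i ⊗ 1 - 1 ⊗ ∂_i`. -/
def hirotaSubst : MvPolynomial ℕ ℚ →ₐ[ℚ] PolyPair := MvPolynomial.aeval (varL - varR)

theorem hirotaSubst_schurScaled (n : ℕ) :
    hirotaSubst (schurScaled 1 n) =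
      ∑ p ∈ antidiagonal n, schurScaled 1 p.1 ⊗ₜ schurScaled (-1) p.2 := by
  rw [schurScaled, map_schurEval]
  have h : ∀ k : ℕ, hirotaSubst (MvPolynomial.C (1 / (k : ℚ)) * MvPolynomial.X k) =
      (Algebra.TensorProduct.includeLeft (R := ℚ) (S := ℚ) (A := MvPolynomial ℕ ℚ)
          (B := MvPolynomial ℕ ℚ)) (MvPolynomial.C (1 / (k : ℚ)) * MvPolynomial.X k) +
        (Algebra.TensorProduct.includeRight (R := ℚ) (A := MvPolynomial ℕ ℚ)
          (B := MvPolynomial ℕ ℚ)) (MvPolynomial.C (-1 / (k : ℚ)) * MvPolynomial.X k) := by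
    intro k
    simp only [← MvPolynomial.smul_eq_C_mul, map_smul, hirotaSubst, MvPolynomial.aeval_X]
    change _ = (1 / (k : ℚ)) • varL k + (-1 / (k : ℚ)) • varR k
    rw [Pi.sub_apply]
    module
  simp_rw [h]
  rw [schurEval_add]
  refine Finset.sum_congr rfl fun p _ => ?_
  rw [← map_schurEval, ← map_schurEval]
  simp only [Algebra.TensorProduct.includeLeft_apply, Algebra.TensorProduct.includeRight_apply,
    Algebra.TensorProduct.tmul_mul_tmul, mul_one, one_mul]
  rfl

theorem coeff_mvExp_varL (s : ℕ →₀ ℕ) :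
    MvPowerSeries.coeff s (mvExp varL) =
      MvPolynomial.monomial s (1 / (multiFactorial s : ℚ)) ⊗ₜ 1 := by
  have : MvPolynomial.aeval (R := ℚ) varL = Algebra.TensorProduct.includeLeft (R := ℚ) (S := ℚ)
      (A := MvPolynomial ℕ ℚ) (B := MvPolynomial ℕ ℚ) := by
    ext i
    rw [MvPolynomial.aeval_X]
    rfl
  rw [← aeval_monomial_eq_mvExp, this]
  rfl

theorem coeff_mvExp_smul_varR (c : ℚ) (s : ℕ →₀ ℕ) :
    MvPowerSeries.coeff s (mvExp (c • varR)) =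
      c ^ s.degree • 1 ⊗ₜ MvPolynomial.monomial s (1 / (multiFactorial s : ℚ)) := by
  have : MvPolynomial.aeval (R := ℚ) varR = Algebra.TensorProduct.includeRight (R := ℚ)
      (A := MvPolynomial ℕ ℚ) (B := MvPolynomial ℕ ℚ) := by
    ext i
    rw [MvPolynomial.aeval_X]
    rfl
  rw [coeff_mvExp_smul, ← aeval_monomial_eq_mvExp, this]
  rfl

/-- The generating series of `p_n(c s) p_{n + 1}(D̃)`, summed over `n`. -/
def residueSeries (c : ℚ) : MvPowerSeries ℕ PolyPair := fun s =>
  (c ^ s.degree / (multiFactorial s : ℚ)) • hirotaSubst (schurScaled 1 (multiWeight s + 1))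

theorem coeff_residueSeries (c : ℚ) (s : ℕ →₀ ℕ) :
    MvPowerSeries.coeff s (residueSeries c) = (c ^ s.degree / (multiFactorial s : ℚ)) •
      hirotaSubst (schurScaled 1 (multiWeight s + 1)) := rfl

theorem hirotaSubst_kpHirotaPoly {s : ℕ →₀ ℕ} (hs : s 0 = 0) :
    hirotaSubst (kpHirotaPoly s) =
      MvPowerSeries.coeff s (residueSeries (-2) * mvExp (varL - varR)) := by
  rw [kpHirotaPoly_eq hs, map_sum, MvPowerSeries.coeff_mul]
  refine Finset.sum_congr rfl fun p _ => ?_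
  rw [map_smul, map_mul, coeff_residueSeries, smul_mul_assoc]
  congr 2
  exact aeval_monomial_eq_mvExp _ _

/-- Once the exponential has the same factor c as the Schur polynomial, c only rescales the
variables y. -/
theorem coeff_residueSeries_mul_mvExp (c : ℚ) (s : ℕ →₀ ℕ) :
    MvPowerSeries.coeff s (residueSeries c * mvExp (c • varR)) =
      c ^ s.degree • MvPowerSeries.coeff s (residueSeries 1 * mvExp ((1 : ℚ) • varR)) := by
  rw [MvPowerSeries.coeff_mul, MvPowerSeries.coeff_mul, Finset.smul_sum]
  refine Finset.sum_congr rfl fun p hp => ?_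
  rw [coeff_residueSeries, coeff_residueSeries, coeff_mvExp_smul_varR, coeff_mvExp_smul_varR,
    ← HasAntidiagonal.mem_antidiagonal.1 hp, map_add, pow_add, one_pow, one_pow, one_smul,
    smul_mul_smul_comm, smul_mul_assoc, smul_smul]
  congr 1
  ring

/-- The substitution `y_i ↦ y_i + λ ^ i`. -/
def twist : MvPolynomial ℕ ℚ →ₐ[ℚ] Polynomial (MvPolynomial ℕ ℚ) :=
  MvPolynomial.aeval fun i => Polynomial.C (MvPolynomial.X i) + Polynomial.X ^ i

theorem twist_X (i : ℕ) :
    twist (MvPolynomial.X i) = Polynomial.C (MvPolynomial.X i) + Polynomial.X ^ i :=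
  MvPolynomial.aeval_X _ _

/-- Taylor expansion of exp(∑ s_i(y_i + λ^i)). The twist records the conjugation of ∂_i by the
vacuum wave function exp(∑ t_i λ^i), which turns ∂_i into ∂_i + λ^i. -/
theorem twist_monomial (s : ℕ →₀ ℕ) :
    twist (MvPolynomial.monomial s (1 / (multiFactorial s : ℚ))) =
      ∑ p ∈ antidiagonal s, (1 / (multiFactorial p.1 : ℚ)) •
        Polynomial.monomial (multiWeight p.1)
          (MvPolynomial.monomial p.2 (1 / (multiFactorial p.2 : ℚ))) := by
  rw [twist, aeval_monomial_eq_mvExp]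
  have : (fun i => Polynomial.C (MvPolynomial.X i) + Polynomial.X ^ i :
      ℕ → Polynomial (MvPolynomial ℕ ℚ)) =
      (fun i => Polynomial.X ^ i) + fun i => Polynomial.CAlgHom (R := ℚ) (MvPolynomial.X i) := by
    ext1 i
    rw [Pi.add_apply, add_comm]
    rfl
  rw [this, mvExp_add, MvPowerSeries.coeff_mul]
  refine Finset.sum_congr rfl fun p _ => ?_
  have hX : MvPowerSeries.coeff p.2 (mvExp MvPolynomial.X) =
      MvPolynomial.monomial p.2 (1 / (multiFactorial p.2 : ℚ)) := by
    rw [← aeval_monomial_eq_mvExp, MvPolynomial.aeval_X_left, AlgHom.id_apply]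
  rw [← map_coeff_mvExp, hX, coeff_mvExp, smul_mul_assoc]
  congr 1
  rw [← Polynomial.C_mul_X_pow_eq_monomial, mul_comm]
  congr 1
  rw [Finsupp.prod, multiWeight, Finsupp.sum, ← Finset.prod_pow_eq_pow_sum]
  simp only [pow_mul]

/-! ### The bilinear residue identity -/

namespace CommDerivations

variable {A : Type*} [CommRing A] [Algebra ℚ A] (D : CommDerivations A)

/-- The residue pairing `(P λ ^ n) ↦ Res λ ^ n (P(∂) f) c`, where `λ = 1 / z`. -/
def residue (f c : PowerSeries A) : Polynomial (MvPolynomial ℕ ℚ) →ₗ[ℚ] A where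
  toFun u := u.sum fun n P => PowerSeries.coeff (n + 1) (D.lift.op P f * c)
  map_add' u v := Polynomial.sum_add_index u v _ (by simp) (by simp [add_mul])
  map_smul' r u := by
    rw [Polynomial.sum_smul_index' u r _ (by simp), Polynomial.sum, Polynomial.sum,
      Finset.smul_sum]
    simp

theorem residue_monomial (f c : PowerSeries A) (n : ℕ) (P : MvPolynomial ℕ ℚ) :
    D.residue f c (Polynomial.monomial n P) = PowerSeries.coeff (n + 1) (D.lift.op P f * c) := by
  simp only [residue, LinearMap.coe_mk, AddHom.coe_mk]
  rw [Polynomial.sum_monomial_index]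
  simp

/-- p_{n+1}(D̃) τ · τ is the coefficient of z^(n+1) in τ(t + [z]) τ(t - [z]). The operator P acts on
the second factor only. -/
theorem residue_tau (τ : A) (n : ℕ) (P : MvPolynomial ℕ ℚ) :
    D.residue (D.shift (-1) τ) (D.shift 1 τ) (Polynomial.monomial n P) =
      D.bilin τ τ (hirotaSubst (schurScaled 1 (n + 1)) * 1 ⊗ₜ P) := by
  rw [residue_monomial, hirotaSubst_schurScaled, Finset.sum_mul, map_sum, mul_comm,
    PowerSeries.coeff_mul]
  refine Finset.sum_congr rfl fun p _ => ?_
  rw [coeff_shift, coeff_lift_op, coeff_shift, Algebra.TensorProduct.tmul_mul_tmul, bilin_tmul,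
    mul_one, mul_comm (schurScaled (-1) p.2), op_mul]

theorem residue_twist_monomial (τ : A) (s : ℕ →₀ ℕ) :
    D.residue (D.shift (-1) τ) (D.shift 1 τ)
        (twist (MvPolynomial.monomial s (1 / (multiFactorial s : ℚ)))) =
      D.bilin τ τ (MvPowerSeries.coeff s (residueSeries 1 * mvExp ((1 : ℚ) • varR))) := by
  rw [twist_monomial, map_sum, MvPowerSeries.coeff_mul, map_sum]
  refine Finset.sum_congr rfl fun p _ => ?_
  rw [map_smul, residue_tau, coeff_residueSeries, coeff_mvExp_smul_varR, one_pow, one_pow, one_smul,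
    smul_mul_assoc, map_smul]

theorem bilin_coeff_mvExp_mul (τ : A) (c : ℚ) (s : ℕ →₀ ℕ) {t : PolyPair}
    (h : D.bilin τ τ t = 0) :
    D.bilin τ τ (t * MvPowerSeries.coeff s (mvExp (c • (varL + varR)))) = 0 := by
  have : MvPowerSeries.coeff s (mvExp (c • (varL + varR))) = polyCoprod
      (c ^ s.degree • MvPolynomial.monomial s (1 / (multiFactorial s : ℚ))) := by
    rw [coeff_mvExp_smul, ← aeval_monomial_eq_mvExp, map_smul]
    rfl
  rw [this, mul_comm, bilin_polyCoprod_mul, h, map_zero]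

/-- With L = ∂ ⊗ 1 and R = 1 ⊗ ∂, the exponents differ by -2R = (L - R) - (L + R). The factor
exp(∓y(L + R)) differentiates the whole bilinear expression, so it preserves vanishing in both
directions. -/
theorem bilin_hirota_iff (τ : A) :
    (∀ s : ℕ →₀ ℕ, s 0 = 0 → D.bilin τ τ (hirotaSubst (kpHirotaPoly s)) = 0) ↔
      ∀ s : ℕ →₀ ℕ, s 0 = 0 → D.residue (D.shift (-1) τ) (D.shift 1 τ)
        (twist (MvPolynomial.monomial s (1 / (multiFactorial s : ℚ)))) = 0 := by
  have e1 : residueSeries (-2) * mvExp ((-2 : ℚ) • varR) =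
      residueSeries (-2) * mvExp (varL - varR) * mvExp ((-1 : ℚ) • (varL + varR)) := by
    rw [mul_assoc, ← mvExp_add]
    congr 2
    module
  have e2 : residueSeries (-2) * mvExp (varL - varR) =
      residueSeries (-2) * mvExp ((-2 : ℚ) • varR) * mvExp ((1 : ℚ) • (varL + varR)) := by
    rw [mul_assoc, ← mvExp_add]
    congr 2
    module
  constructor
  · intro h s hs
    rw [residue_twist_monomial]
    have h2 : ((-2 : ℚ) ^ s.degree) • D.bilin τ τ
        (MvPowerSeries.coeff s (residueSeries 1 * mvExp ((1 : ℚ) • varR))) = 0 := by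
      rw [← map_smul, ← coeff_residueSeries_mul_mvExp, e1, MvPowerSeries.coeff_mul, map_sum]
      refine Finset.sum_eq_zero fun p hp => ?_
      have h0 := add_apply_zero_of_mem_antidiagonal hp 0
      refine D.bilin_coeff_mvExp_mul τ _ _ ?_
      rw [← hirotaSubst_kpHirotaPoly (by omega)]
      exact h _ (by omega)
    exact (smul_eq_zero_iff_right (pow_ne_zero _ (by norm_num))).1 h2
  · intro h s hs
    rw [hirotaSubst_kpHirotaPoly hs, e2, MvPowerSeries.coeff_mul, map_sum]
    refine Finset.sum_eq_zero fun p hp => ?_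
    have h0 := add_apply_zero_of_mem_antidiagonal hp 0
    refine D.bilin_coeff_mvExp_mul τ _ _ ?_
    rw [coeff_residueSeries_mul_mvExp, map_smul, ← residue_twist_monomial, h _ (by omega), smul_zero]

theorem lift_op_X_zero (f : PowerSeries A) : D.lift.op (MvPolynomial.X 0) f = 0 := by
  rw [op_X, D.lift.der_zero, Derivation.zero_apply]

theorem residue_C_X_zero_mul (f c : PowerSeries A) (u : Polynomial (MvPolynomial ℕ ℚ)) :
    D.residue f c (Polynomial.C (MvPolynomial.X 0) * u) = 0 := by
  induction u using Polynomial.induction_on' with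
  | add u v hu hv => rw [mul_add, map_add, hu, hv, add_zero]
  | monomial n P =>
    rw [Polynomial.C_mul_monomial, residue_monomial, op_mul, lift_op_X_zero, zero_mul, map_zero]

/-- As ∂_0 = 0, the twisted variable y_0 + 1 acts as the identity, so powers of y_0 can be stripped
off. -/
theorem residue_twist_eq_zero {f c : PowerSeries A}
    (h : ∀ s : ℕ →₀ ℕ, s 0 = 0 →
      D.residue f c (twist (MvPolynomial.monomial s (1 / (multiFactorial s : ℚ)))) = 0)
    (Q : MvPolynomial ℕ ℚ) : D.residue f c (twist Q) = 0 := by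
  have h1 : ∀ n : ℕ, ∀ s : ℕ →₀ ℕ, s 0 = n →
      D.residue f c (twist (MvPolynomial.monomial s 1)) = 0 := by
    intro n
    induction n with
    | zero =>
      intro s hs
      have h0 : (multiFactorial s : ℚ) ≠ 0 := by exact_mod_cast multiFactorial_ne_zero s
      have : (MvPolynomial.monomial s 1 : MvPolynomial ℕ ℚ) =
          (multiFactorial s : ℚ) • MvPolynomial.monomial s (1 / (multiFactorial s : ℚ)) := by
        rw [MvPolynomial.smul_monomial, smul_eq_mul, mul_one_div_cancel h0]
      rw [this, map_smul, map_smul, h s hs, smul_zero]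
    | succ n ih =>
      intro s hs
      obtain ⟨t, rfl⟩ := exists_add_single_of_ne_zero (s := s) (i := 0) (by omega)
      have ht : t 0 = n := by simpa using hs
      have : (MvPolynomial.monomial (t + Finsupp.single 0 1) 1 : MvPolynomial ℕ ℚ) =
          MvPolynomial.X 0 * MvPolynomial.monomial t 1 := by
        rw [MvPolynomial.X, MvPolynomial.monomial_mul, add_comm, one_mul]
      rw [this, map_mul, twist_X, pow_zero, add_mul, one_mul, map_add, residue_C_X_zero_mul,
        ih t ht, add_zero]
  induction Q using MvPolynomial.induction_on' with
  | add P Q hP hQ => rw [map_add, map_add, hP, hQ, add_zero]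
  | monomial s a =>
    have : (MvPolynomial.monomial s a : MvPolynomial ℕ ℚ) = a • MvPolynomial.monomial s 1 := by
      rw [MvPolynomial.smul_monomial, smul_eq_mul, mul_one]
    rw [this, map_smul, map_smul, h1 _ s rfl, smul_zero]

end CommDerivations

/-! ### Translation of the Hirota equations -/

theorem prod_choose_eq {s : ℕ →₀ ℕ} {p : (ℕ →₀ ℕ) × (ℕ →₀ ℕ)} (hp : p ∈ antidiagonal s) :
    (s.prod fun i k => (k.choose (p.1 i) : ℚ)) =
      multiFactorial s / (multiFactorial p.1 * multiFactorial p.2) := by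
  have hadd := add_apply_zero_of_mem_antidiagonal hp
  have h1 : multiFactorial p.1 = ∏ i ∈ s.support, (p.1 i).factorial :=
    Finsupp.prod_of_support_subset _ (fun i hi => by
      rw [Finsupp.mem_support_iff] at hi ⊢
      have := hadd i
      omega) _ (by simp)
  have h2 : multiFactorial p.2 = ∏ i ∈ s.support, (p.2 i).factorial :=
    Finsupp.prod_of_support_subset _ (fun i hi => by
      rw [Finsupp.mem_support_iff] at hi ⊢
      have := hadd i
      omega) _ (by simp)
  have h3 : (multiFactorial p.1 : ℚ) ≠ 0 := by exact_mod_cast multiFactorial_ne_zero p.1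
  have h4 : (multiFactorial p.2 : ℚ) ≠ 0 := by exact_mod_cast multiFactorial_ne_zero p.2
  rw [eq_div_iff (mul_ne_zero h3 h4), h1, h2, multiFactorial, Finsupp.prod, Finsupp.prod]
  push_cast
  rw [← Finset.prod_mul_distrib, ← Finset.prod_mul_distrib]
  refine Finset.prod_congr rfl fun i _ => ?_
  have := hadd i
  have h := Nat.choose_mul_factorial_mul_factorial (show p.1 i ≤ s i by omega)
  rw [show s i - p.1 i = p.2 i by omega] at h
  rw [← mul_assoc]
  exact_mod_cast h

section Translation

variable {A : Type*} [CommRing A] [Algebra ℚ A] {d : ℕ → Derivation ℚ A A}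
  {hcomm : ∀ m n, 1 ≤ m → 1 ≤ n → ∀ f, d m (d n f) = d n (d m f)}

/-- In divided powers the Leibniz expansion is the factorisation exp(y(L - R)) = exp(yL) exp(-yR);
the binomial coefficients are quotients of the factorials. -/
theorem hirotaMonomial_eq (τ : A) {s : ℕ →₀ ℕ} (hs : s 0 = 0) :
    hirotaMonomial d s τ τ = (CommDerivations.mk' d hcomm).bilin τ τ
      (hirotaSubst (MvPolynomial.monomial s 1)) := by
  have h0 : (multiFactorial s : ℚ) ≠ 0 := by exact_mod_cast multiFactorial_ne_zero s
  have h1 : (MvPolynomial.monomial s 1 : MvPolynomial ℕ ℚ) =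
      (multiFactorial s : ℚ) • MvPolynomial.monomial s (1 / (multiFactorial s : ℚ)) := by
    rw [MvPolynomial.smul_monomial, smul_eq_mul, mul_one_div_cancel h0]
  have h2 : varL - varR = varL + (-1 : ℚ) • varR := by module
  have h3 : ∀ t : ℕ →₀ ℕ,
      (MvPolynomial.monomial t (1 / (multiFactorial t : ℚ)) : MvPolynomial ℕ ℚ) =
        (1 / (multiFactorial t : ℚ)) • MvPolynomial.monomial t 1 := by
    intro t
    rw [MvPolynomial.smul_monomial, smul_eq_mul, mul_one]
  rw [h1, map_smul, hirotaSubst, aeval_monomial_eq_mvExp, h2, mvExp_add, MvPowerSeries.coeff_mul,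
    map_smul, map_sum, Finset.smul_sum, hirotaMonomial]
  refine Finset.sum_congr rfl fun p hp => ?_
  have hadd := add_apply_zero_of_mem_antidiagonal hp 0
  rw [coeff_mvExp_varL, coeff_mvExp_smul_varR, mul_smul_comm,
    Algebra.TensorProduct.tmul_mul_tmul, mul_one, one_mul, map_smul, CommDerivations.bilin_tmul,
    monomialOp_eq (hcomm := hcomm) (s := p.1) (by omega),
    monomialOp_eq (hcomm := hcomm) (s := p.2) (by omega), h3, h3, map_smul, map_smul,
    LinearMap.smul_apply, LinearMap.smul_apply, smul_mul_smul_comm, smul_smul, smul_smul,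
    prod_choose_eq hp]
  congr 1
  have : (p.2.sum fun _ k => k) = p.2.degree := rfl
  rw [this]
  field_simp

theorem kpHirota_iff (τ : A) :
    KPHirota d τ ↔ ∀ Q, (CommDerivations.mk' d hcomm).residue
      ((CommDerivations.mk' d hcomm).shift (-1) τ) ((CommDerivations.mk' d hcomm).shift 1 τ)
      (twist Q) = 0 := by
  have h : KPHirota d τ ↔ ∀ s : ℕ →₀ ℕ, s 0 = 0 →
      (CommDerivations.mk' d hcomm).bilin τ τ (hirotaSubst (kpHirotaPoly s)) = 0 := by
    refine forall_congr' fun s => forall_congr' fun hs => ?_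
    conv_rhs => rw [(kpHirotaPoly s).as_sum, map_sum, map_sum]
    rw [hirotaBilinear]
    refine Eq.congr_left (Finset.sum_congr rfl fun t ht => ?_)
    rw [hirotaMonomial_eq (hcomm := hcomm) τ (kpHirotaPoly_support hs t ht), ← map_smul, ← map_smul,
      MvPolynomial.smul_monomial, smul_eq_mul, mul_one]
  rw [h, CommDerivations.bilin_hirota_iff]
  exact ⟨fun h => CommDerivations.residue_twist_eq_zero _ h, fun h s _ => h _⟩

end Translation

/-! ### The residue identity implies (*) -/

/-- These are the coefficients of (1 - xz)^(-2). This double pole is the reason for shifting by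
2[z]. -/
theorem schurEval_geometric_two {S : Type*} [CommRing S] [Algebra ℚ S] (n : ℕ) (x : S) :
    schurEval n (fun k => (2 / k : ℚ) • x ^ k) = (n + 1) * x ^ n := by
  have : (fun k : ℕ => (2 / k : ℚ) • x ^ k) =
      fun k : ℕ => (1 / k : ℚ) • x ^ k + (1 / k : ℚ) • x ^ k := by
    ext1 k
    rw [← add_smul, ← add_div, one_add_one_eq_two]
  rw [this, schurEval_add]
  have h : ∀ p ∈ antidiagonal n, schurEval p.1 (fun k : ℕ => (1 / k : ℚ) • x ^ k) *
      schurEval p.2 (fun k : ℕ => (1 / k : ℚ) • x ^ k) = x ^ n := by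
    intro p hp
    rw [schurEval_geometric, schurEval_geometric, ← pow_add,
      HasAntidiagonal.mem_antidiagonal.1 hp]
  rw [Finset.sum_congr rfl h, Finset.sum_const, Finset.Nat.card_antidiagonal, nsmul_eq_mul]
  push_cast
  ring

theorem twist_schurScaled (c : ℚ) (n : ℕ) :
    twist (schurScaled c n) = ∑ p ∈ antidiagonal n, Polynomial.C (schurScaled c p.1) *
      schurEval p.2 fun k => (c / (k : ℚ)) • (Polynomial.X : Polynomial (MvPolynomial ℕ ℚ)) ^ k := by
  rw [schurScaled_eq, map_schurEval]
  have : (fun k : ℕ => twist ((c / (k : ℚ)) • MvPolynomial.X k)) =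
      fun k : ℕ => Polynomial.CAlgHom (R := ℚ) ((c / (k : ℚ)) • MvPolynomial.X k) +
        (c / (k : ℚ)) • Polynomial.X ^ k := by
    ext1 k
    rw [map_smul, twist_X, smul_add, map_smul]
    rfl
  rw [this, schurEval_add]
  refine Finset.sum_congr rfl fun p _ => ?_
  rw [← map_schurEval, ← schurScaled_eq]
  rfl

theorem sum_antidiagonal_assoc {M : Type*} [AddCommMonoid M] (g : ℕ → ℕ → ℕ → M) (n : ℕ) :
    ∑ p ∈ antidiagonal n, ∑ q ∈ antidiagonal p.1, g q.1 q.2 p.2 =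
      ∑ p ∈ antidiagonal n, ∑ q ∈ antidiagonal p.2, g p.1 q.1 q.2 := by
  simp only [Finset.sum_sigma']
  refine Finset.sum_nbij' (fun x => ⟨(x.2.1, x.2.2 + x.1.2), (x.2.2, x.1.2)⟩)
    (fun x => ⟨(x.1.1 + x.2.1, x.2.2), (x.1.1, x.2.1)⟩) ?_ ?_ ?_ ?_ ?_
  · rintro ⟨⟨a, b⟩, ⟨e, f⟩⟩ h
    simp only [Finset.mem_sigma, HasAntidiagonal.mem_antidiagonal] at h ⊢
    exact ⟨by omega, trivial⟩
  · rintro ⟨⟨a, b⟩, ⟨e, f⟩⟩ h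
    simp only [Finset.mem_sigma, HasAntidiagonal.mem_antidiagonal] at h ⊢
    exact ⟨by omega, trivial⟩
  · rintro ⟨⟨a, b⟩, ⟨e, f⟩⟩ h
    simp only [Finset.mem_sigma, HasAntidiagonal.mem_antidiagonal] at h ⊢
    obtain ⟨-, rfl⟩ := h
    rfl
  · rintro ⟨⟨a, b⟩, ⟨e, f⟩⟩ h
    simp only [Finset.mem_sigma, HasAntidiagonal.mem_antidiagonal] at h ⊢
    obtain ⟨-, rfl⟩ := h
    rfl
  · rintro ⟨⟨a, b⟩, ⟨e, f⟩⟩ _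
    rfl

namespace CommDerivations

variable {A : Type*} [CommRing A] [Algebra ℚ A] (D : CommDerivations A)

theorem hshift_hshift (c c' : ℚ) (f : PowerSeries A) :
    D.hshift c (D.hshift c' f) = D.hshift (c + c') f := by
  ext n
  simp only [coeff_hshift, map_sum]
  rw [sum_antidiagonal_assoc fun i j k => D.sop c k (D.sop c' j (PowerSeries.coeff i f))]
  refine Finset.sum_congr rfl fun p _ => ?_
  rw [sop_add, ← Finset.Nat.sum_antidiagonal_swap]
  rfl

/-- The coefficientwise derivative of a series with coefficients in a power series ring. -/
def innerDerivative (A : Type*) [CommRing A] [Algebra ℚ A] :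
    Derivation ℚ (PowerSeries (PowerSeries A)) (PowerSeries (PowerSeries A)) :=
  ((PowerSeries.derivative A).restrictScalars ℚ).liftPowerSeries

theorem coeff_innerDerivative (n : ℕ) (H : PowerSeries (PowerSeries A)) :
    PowerSeries.coeff n (innerDerivative A H) =
      PowerSeries.derivative A (PowerSeries.coeff n H) :=
  Derivation.coeff_liftPowerSeries _ _ _

theorem derivative_lift_op (P : MvPolynomial ℕ ℚ) (f : PowerSeries A) :
    PowerSeries.derivative A (D.lift.op P f) = D.lift.op P (PowerSeries.derivative A f) := by
  ext n
  rw [PowerSeries.coeff_derivative, coeff_lift_op, coeff_lift_op, PowerSeries.coeff_derivative]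
  have h : ∀ a : A, a * ((n : A) + 1) = ((n + 1 : ℕ) : ℚ) • a := by
    intro a
    rw [Algebra.smul_def, map_natCast, mul_comm]
    push_cast
    rfl
  rw [h, h, map_smul]

theorem innerDerivative_shift (c : ℚ) (f : PowerSeries A) :
    innerDerivative A (D.lift.shift c f) = D.lift.shift c (PowerSeries.derivative A f) := by
  ext1 n
  rw [coeff_innerDerivative, coeff_shift, coeff_shift, derivative_lift_op]

theorem innerDerivative_C (f : PowerSeries A) :
    innerDerivative A (PowerSeries.C f) = PowerSeries.C (PowerSeries.derivative A f) := by
  ext1 n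
  rw [coeff_innerDerivative, PowerSeries.coeff_C, PowerSeries.coeff_C]
  split_ifs <;> simp

theorem diagSeries_innerDerivative (f c : PowerSeries A) :
    diagSeries (innerDerivative A (D.lift.shift 2 f * PowerSeries.C c)) =
      D.hshift 2 (PowerSeries.derivative A f) * c +
        D.hshift 2 f * PowerSeries.derivative A c := by
  rw [Derivation.leibniz, innerDerivative_shift, innerDerivative_C, smul_eq_mul, smul_eq_mul,
    map_add, map_mul, map_mul, diagSeries_C, diagSeries_C, diagSeries_shift, diagSeries_shift]
  ring

/-- An inner exponent j is weighted by j - 1 for j ≥ 2. On the right the weight is j - 1 as well,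
and the last term corrects the value -1 at j = 0. -/
theorem sq_mul_secondDifference (H : PowerSeries (PowerSeries A)) :
    PowerSeries.X * (PowerSeries.X * PowerSeries.mk fun n => ∑ p ∈ antidiagonal n,
        ((p.2 : A) + 1) * PowerSeries.coeff (p.2 + 2) (PowerSeries.coeff p.1 H)) =
      PowerSeries.X * diagSeries (innerDerivative A H) - diagSeries H +
        PowerSeries.map PowerSeries.constantCoeff H := by
  ext n
  rw [map_add, map_sub, PowerSeries.coeff_map, coeff_diagSeries]
  rcases n with _ | _ | n
  · simp
  · rw [PowerSeries.coeff_succ_X_mul, PowerSeries.coeff_zero_X_mul, PowerSeries.coeff_succ_X_mul,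
      coeff_diagSeries]
    simp [coeff_innerDerivative, PowerSeries.coeff_derivative, Finset.Nat.antidiagonal_succ]
  · rw [PowerSeries.coeff_succ_X_mul, PowerSeries.coeff_succ_X_mul, PowerSeries.coeff_succ_X_mul,
      PowerSeries.coeff_mk, coeff_diagSeries]
    simp only [coeff_innerDerivative, PowerSeries.coeff_derivative]
    have : ∑ q ∈ antidiagonal (n + 1),
          PowerSeries.coeff (q.2 + 1) (PowerSeries.coeff q.1 H) * ((q.2 : A) + 1) =
        ∑ q ∈ antidiagonal (n + 1), PowerSeries.coeff (q.2 + 1) (PowerSeries.coeff q.1 H) +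
          ∑ p ∈ antidiagonal n,
            ((p.2 : A) + 1) * PowerSeries.coeff (p.2 + 2) (PowerSeries.coeff p.1 H) := by
      simp only [mul_add, mul_one, Finset.sum_add_distrib]
      rw [add_comm]
      congr 1
      rw [Finset.Nat.sum_antidiagonal_succ']
      simp only [Nat.cast_zero, mul_zero, zero_add, Nat.cast_add, Nat.cast_one]
      refine Finset.sum_congr rfl fun p _ => ?_
      rw [mul_comm]
    rw [this, Finset.Nat.sum_antidiagonal_succ'
      (n := n + 1), PowerSeries.coeff_zero_eq_constantCoeff_apply]
    ring

/-- The twist is (∂_1 + λ) ∑ p_i(2∂̃) (j + 1) λ^j. The ∂_1-part produces an inner derivative, the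
λ-part the second difference of `sq_mul_secondDifference`. -/
theorem residue_twist_two (f c : PowerSeries A) (n : ℕ) :
    D.residue f c (twist (MvPolynomial.X 1 * schurScaled 2 n)) =
      PowerSeries.coeff n (diagSeries (innerDerivative A
        (D.lift.shift 2 (D.lift.der 1 f) * PowerSeries.C c))) +
      ∑ p ∈ antidiagonal n, ((p.2 : A) + 1) * PowerSeries.coeff (p.2 + 2)
        (PowerSeries.coeff p.1 (D.lift.shift 2 f * PowerSeries.C c)) := by
  rw [map_mul, twist_X, pow_one, twist_schurScaled, Finset.mul_sum, map_sum, coeff_diagSeries,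
    ← Finset.sum_add_distrib]
  refine Finset.sum_congr rfl fun p _ => ?_
  have : (Polynomial.C (MvPolynomial.X 1) + Polynomial.X) * (Polynomial.C (schurScaled 2 p.1) *
      schurEval p.2 fun k => (2 / (k : ℚ)) • (Polynomial.X : Polynomial (MvPolynomial ℕ ℚ)) ^ k) =
      ((p.2 + 1 : ℕ) : ℚ) • Polynomial.monomial p.2 (schurScaled 2 p.1 * MvPolynomial.X 1) +
        ((p.2 + 1 : ℕ) : ℚ) • Polynomial.monomial (p.2 + 1) (schurScaled 2 p.1) := by
    rw [schurEval_geometric_two, ← Polynomial.C_mul_X_pow_eq_monomial,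
      ← Polynomial.C_mul_X_pow_eq_monomial, Algebra.smul_def, Algebra.smul_def, map_natCast,
      map_mul]
    push_cast
    ring
  rw [this, map_add, map_smul, map_smul, residue_monomial, residue_monomial, op_mul, op_X,
    coeff_innerDerivative, PowerSeries.coeff_derivative, PowerSeries.coeff_mul_C,
    PowerSeries.coeff_mul_C, coeff_shift, coeff_shift, Algebra.smul_def, Algebra.smul_def,
    map_natCast]
  push_cast
  ring

variable {D} {τ F : A}

theorem IsLog.shift_identity (h : D.IsLog τ F)
    (hres : ∀ Q, D.residue (D.shift (-1) τ) (D.shift 1 τ) (twist Q) = 0) :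
    D.shift 2 τ * PowerSeries.C τ - D.shift 1 τ ^ 2 = PowerSeries.X * (PowerSeries.X *
      (D.shift 1 τ ^ 2 * D.hshift 1 (D.gen (D.der 1 F)))) := by
  set f := D.shift (-1) τ with hf
  set c := D.shift 1 τ with hc
  have hsum : diagSeries (innerDerivative A
        (D.lift.shift 2 (D.lift.der 1 f) * PowerSeries.C c)) +
      PowerSeries.mk (fun n => ∑ p ∈ antidiagonal n, ((p.2 : A) + 1) * PowerSeries.coeff (p.2 + 2)
        (PowerSeries.coeff p.1 (D.lift.shift 2 f * PowerSeries.C c))) = 0 := by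
    ext n
    rw [map_add, PowerSeries.coeff_mk, ← residue_twist_two, hres, map_zero]
  have hsq := sq_mul_secondDifference (D.lift.shift 2 f * PowerSeries.C c)
  have hgen : ∀ a : A, D.hshift 2 (PowerSeries.derivative A (D.shift (-1) a)) =
      -D.hshift 1 (D.gen a) := by
    intro a
    have : PowerSeries.derivative A (D.shift (-1) a) = -D.hshift (-1) (D.gen a) := by
      rw [CommDerivations.derivative_shift, neg_smul, one_smul]
    rw [this, map_neg, hshift_hshift]
    norm_num
  -- On the diagonal both factors are τ(t + [z]). Their derivatives are opposite, since τ(t - [z])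
  -- and τ(t + [z]) move in opposite directions.
  have hd1 : diagSeries (innerDerivative A (D.lift.shift 2 f * PowerSeries.C c)) = 0 := by
    rw [diagSeries_innerDerivative, hf, hgen, hshift_shift, hc, CommDerivations.derivative_shift,
      one_smul]
    norm_num
    ring
  have hd2 : diagSeries (innerDerivative A
        (D.lift.shift 2 (D.lift.der 1 f) * PowerSeries.C c)) =
      -(c ^ 2 * D.hshift 1 (D.gen (D.der 1 F))) := by
    -- The quotient rule for ∂_n(∂_1 τ / τ), cleared of denominators.
    have hg : PowerSeries.C τ * D.gen (D.der 1 τ) =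
        PowerSeries.C (D.der 1 τ) * D.gen τ +
          PowerSeries.C (τ ^ 2) * D.gen (D.der 1 F) := by
      ext n
      simp only [gen, PowerSeries.coeff_C_mul, PowerSeries.coeff_mk, map_add]
      rw [h 1, Derivation.leibniz, h (n + 1)]
      simp only [smul_eq_mul]
      ring
    have hg := congrArg (D.hshift 1) hg
    rw [map_add, map_mul, map_mul, map_mul, hshift_C, hshift_C, hshift_C, map_pow, ← hc] at hg
    rw [diagSeries_innerDerivative, hf, lift_der_shift, hgen, hshift_shift, hc,
      CommDerivations.derivative_shift, one_smul]
    norm_num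
    rw [← hc]
    linear_combination -hg
  have hmap : PowerSeries.map PowerSeries.constantCoeff (D.lift.shift 2 f * PowerSeries.C c) =
      D.shift 2 τ * PowerSeries.C τ := by
    ext n
    rw [PowerSeries.coeff_map, PowerSeries.coeff_mul_C, PowerSeries.coeff_mul_C, coeff_shift,
      map_mul, coeff_shift, ← PowerSeries.coeff_zero_eq_constantCoeff_apply, coeff_lift_op, hf,
      coeff_shift, sop_zero, hc, ← PowerSeries.coeff_zero_eq_constantCoeff_apply, coeff_shift,
      sop_zero]
  have hdiag : diagSeries (D.lift.shift 2 f * PowerSeries.C c) = c ^ 2 := by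
    rw [map_mul, diagSeries_C, diagSeries_shift, hf, hshift_shift, hc]
    norm_num
    ring
  rw [hd1, hmap, hdiag, mul_zero, eq_neg_of_add_eq_zero_right hsum, hd2] at hsq
  linear_combination -hsq

theorem IsLog.schurSeries_eq (h : D.IsLog τ F) (hτ : IsUnit τ)
    (hres : ∀ Q, D.residue (D.shift (-1) τ) (D.shift 1 τ) (twist Q) = 0) :
    schurSeries (fun j => PowerSeries.coeff j (D.zSeries F)) =
      1 + PowerSeries.X * (PowerSeries.X * D.hshift (-1) (D.gen (D.der 1 F))) := by
  -- Translation by -2[z] sends t + 2[z] to t and t + [z] to t - [z], where the exponential of the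
  -- Z_j lives.
  have h1 := congrArg (D.hshift (-2)) (h.shift_identity hres)
  simp only [map_sub, map_mul, map_pow, hshift_shift, hshift_C, hshift_X, hshift_hshift] at h1
  norm_num at h1
  rw [shift_zero_left] at h1
  have h2 := h.schurSeries_zSeries
  refine ((hτ.map (D.shift (-1))).pow 2).mul_right_cancel ?_
  linear_combination h2 + h1

end CommDerivations

/-! ### Dressing functions and the differential Fay identity -/

namespace CommDerivations

variable {A : Type*} [CommRing A] [Algebra ℚ A] {D : CommDerivations A} {τ F : A}

theorem op_mem {I : NonUnitalSubalgebra ℚ A} (hI : ∀ n, ∀ f ∈ I, D.der n f ∈ I)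
    (P : MvPolynomial ℕ ℚ) {f : A} (hf : f ∈ I) : D.op P f ∈ I := by
  induction P using MvPolynomial.induction_on generalizing f with
  | C r =>
    rw [← MvPolynomial.algebraMap_eq, AlgHom.commutes, Module.algebraMap_end_apply]
    exact I.smul_mem _ hf
  | add P Q hP hQ =>
    rw [map_add]
    exact I.add_mem (hP hf) (hQ hf)
  | mul_X P i hP =>
    rw [op_mul, op_X]
    exact hP (hI i f hf)

/-- The power series with coefficients in a non-unital subalgebra. -/
def seriesSubalgebra (I : NonUnitalSubalgebra ℚ A) : NonUnitalSubalgebra ℚ (PowerSeries A) where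
  carrier := {f | ∀ n, PowerSeries.coeff n f ∈ I}
  add_mem' hf hg n := by
    rw [map_add]
    exact I.add_mem (hf n) (hg n)
  zero_mem' n := by
    rw [map_zero]
    exact I.zero_mem
  mul_mem' hf hg n := by
    rw [PowerSeries.coeff_mul]
    exact I.sum_mem fun p _ => I.mul_mem (hf _) (hg _)
  smul_mem' r f hf n := by
    rw [PowerSeries.coeff_smul]
    exact I.smul_mem _ (hf n)

theorem lift_shift_C (c : ℚ) (a : A) :
    D.lift.shift c (PowerSeries.C a) = PowerSeries.map PowerSeries.C (D.shift c a) := by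
  ext1 n
  rw [coeff_shift, PowerSeries.coeff_map, coeff_shift, lift_op_C]

theorem lift_shift_X (c : ℚ) : D.lift.shift c (PowerSeries.X : PowerSeries A) =
    PowerSeries.C PowerSeries.X := by
  have h : ∀ P : MvPolynomial ℕ ℚ, ∀ a : A, D.lift.op P (PowerSeries.X * PowerSeries.C a) =
      PowerSeries.X * PowerSeries.C (D.op P a) := by
    intro P a
    ext n
    rw [coeff_lift_op]
    rcases n with _ | n
    · simp
    · rw [PowerSeries.coeff_succ_X_mul, PowerSeries.coeff_succ_X_mul, PowerSeries.coeff_C,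
        PowerSeries.coeff_C]
      split_ifs <;> simp
  ext1 n
  have := h (schurScaled c n) 1
  rw [map_one, mul_one] at this
  rw [coeff_shift, this]
  have h1 := D.sop_const_one c n
  rw [sop] at h1
  rw [h1, PowerSeries.coeff_C]
  split_ifs <;> simp

/-- The data attached to a dressing function `w = exp (shift F - F)` with inverse `wi`. -/
structure IsDressing (D : CommDerivations A) (F : A) (w wi : PowerSeries A) : Prop where
  mul_inv : w * wi = 1
  der : ∀ n, D.lift.der n w = w * (D.shift (-1) (D.der n F) - PowerSeries.C (D.der n F))
  constantCoeff : PowerSeries.constantCoeff w = 1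
  coeff_one : PowerSeries.coeff 1 w = -D.der 1 F
  diag : D.hshift (-1) w * wi = schurSeries fun j => PowerSeries.coeff j (D.zSeries F)

/-- The witnesses are w = τ(t - [z]) / τ(t) and its inverse. After this point only F, w and the
inverse enter the Fay argument. -/
theorem IsLog.exists_dressing (h : D.IsLog τ F) (hτ : IsUnit τ) :
    ∃ w wi, w * PowerSeries.C τ = D.shift (-1) τ ∧ D.IsDressing F w wi := by
  obtain ⟨σ, hσ⟩ := hτ.exists_right_inv
  have hσC : PowerSeries.C τ * PowerSeries.C σ = 1 := by rw [← map_mul, hσ, map_one]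
  have hσS : D.shift (-1) τ * D.shift (-1) σ = 1 := by rw [← map_mul, hσ, map_one]
  have hw : D.shift (-1) τ * PowerSeries.C σ * PowerSeries.C τ = D.shift (-1) τ := by
    linear_combination D.shift (-1) τ * hσC
  refine ⟨D.shift (-1) τ * PowerSeries.C σ, D.shift (-1) σ * PowerSeries.C τ, hw, ?_, ?_, ?_, ?_, ?_⟩
  · linear_combination D.shift (-1) τ * D.shift (-1) σ * hσC + hσS
  · intro n
    have hd : D.der n σ = -σ * D.der n F := by
      have := congrArg (D.der n) hσ
      rw [Derivation.leibniz, Derivation.map_one_eq_zero, h n] at this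
      simp only [smul_eq_mul] at this
      linear_combination σ * this - (D.der n σ + σ * D.der n F) * hσ
    rw [Derivation.leibniz, lift_der_shift, lift_der_C, hd, h n, map_mul, map_mul, map_neg]
    simp only [smul_eq_mul]
    ring
  · rw [map_mul, constantCoeff_shift, PowerSeries.constantCoeff_C, hσ]
  · rw [PowerSeries.coeff_mul_C, coeff_shift, sop_one, neg_smul, one_smul, h 1]
    linear_combination -D.der 1 F * hσ
  · have h1 : D.hshift (-1) (D.shift (-1) τ * PowerSeries.C σ) * D.shift (-1) τ =
        D.shift (-2) τ := by
      have := congrArg (D.hshift (-1)) hw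
      rwa [map_mul, hshift_C, hshift_shift, show (-1 : ℚ) + -1 = -2 by norm_num] at this
    have h2 := h.schurSeries_zSeries
    refine ((hτ.map (D.shift (-1))).pow 2).mul_right_cancel ?_
    rw [h2]
    linear_combination D.shift (-1) τ * D.shift (-1) σ * PowerSeries.C τ * h1 +
      D.shift (-2) τ * PowerSeries.C τ * hσS

variable {w wi : PowerSeries A}

theorem IsDressing.der_inv (h : D.IsDressing F w wi) (n : ℕ) :
    D.lift.der n wi = -wi * (D.shift (-1) (D.der n F) - PowerSeries.C (D.der n F)) := by
  have := congrArg (D.lift.der n) h.mul_inv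
  rw [Derivation.leibniz, Derivation.map_one_eq_zero, h.der n] at this
  simp only [smul_eq_mul] at this
  linear_combination wi * this - (D.lift.der n wi +
    wi * (D.shift (-1) (D.der n F) - PowerSeries.C (D.der n F))) * h.mul_inv

/-- `τ(t - [x] - [z]) τ(t) / (τ(t - [x]) τ(t - [z]))` as a power series in `z` over the power
series in `x`. -/
def tauQuotient (D : CommDerivations A) (w wi : PowerSeries A) : PowerSeries (PowerSeries A) :=
  D.lift.shift (-1) w * PowerSeries.C wi

theorem coeff_tauQuotient (n : ℕ) :
    PowerSeries.coeff n (D.tauQuotient w wi) = D.lift.sop (-1) n w * wi := by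
  rw [tauQuotient, PowerSeries.coeff_mul_C, coeff_shift]

/-- The series `∑ g_{a + b + 1} x ^ a z ^ b` with `g_k = p_k(-∂̃) f`. -/
def hankelSeries (D : CommDerivations A) (f : A) : PowerSeries (PowerSeries A) :=
  PowerSeries.mk fun b => PowerSeries.mk fun a => D.sop (-1) (a + b + 1) f

theorem coeff_coeff_hankelSeries (f : A) (a b : ℕ) :
    PowerSeries.coeff a (PowerSeries.coeff b (D.hankelSeries f)) = D.sop (-1) (a + b + 1) f := by
  rw [hankelSeries, PowerSeries.coeff_mk, PowerSeries.coeff_mk]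

/-- The Hankel series is the divided difference of f(t - [z]), so it is regular on the diagonal. -/
theorem sub_mul_hankelSeries (f : A) :
    (PowerSeries.X - PowerSeries.C PowerSeries.X) * D.hankelSeries f =
      PowerSeries.map PowerSeries.C (D.shift (-1) f) - PowerSeries.C (D.shift (-1) f) := by
  ext b a
  rw [sub_mul, map_sub, map_sub, PowerSeries.coeff_C_mul, map_sub, map_sub, PowerSeries.coeff_map,
    coeff_shift, PowerSeries.coeff_C]
  rcases b with _ | b <;> rcases a with _ | a
  · simp [sop_zero, coeff_shift]
  · rw [PowerSeries.coeff_zero_X_mul, PowerSeries.coeff_succ_X_mul, coeff_coeff_hankelSeries]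
    simp [coeff_shift, PowerSeries.coeff_C]
  · rw [PowerSeries.coeff_zero_X_mul, PowerSeries.coeff_succ_X_mul, coeff_coeff_hankelSeries]
    simp
  · rw [PowerSeries.coeff_succ_X_mul, PowerSeries.coeff_succ_X_mul, coeff_coeff_hankelSeries,
      coeff_coeff_hankelSeries, show a + 1 + b = a + (b + 1) by omega]
    simp

theorem diagSeries_hankelSeries (f : A) :
    diagSeries (D.hankelSeries f) = -D.hshift (-1) (D.gen f) := by
  have : -D.hshift (-1) (D.gen f) = PowerSeries.derivative A (D.shift (-1) f) := by
    rw [derivative_shift, neg_smul, one_smul]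
  ext n
  rw [this, PowerSeries.coeff_derivative, coeff_diagSeries, coeff_shift]
  have h : ∀ q ∈ antidiagonal n, PowerSeries.coeff q.2 (PowerSeries.coeff q.1 (D.hankelSeries f)) =
      D.sop (-1) (n + 1) f := by
    intro q hq
    rw [coeff_coeff_hankelSeries, ← HasAntidiagonal.mem_antidiagonal.1 hq, add_comm q.2]
  rw [Finset.sum_congr rfl h, Finset.sum_const, Finset.Nat.card_antidiagonal, nsmul_eq_mul]
  push_cast
  ring

/-- The defect of the differential Fay identity. -/
def fayDefect (D : CommDerivations A) (F : A) (w wi : PowerSeries A) :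
    PowerSeries (PowerSeries A) :=
  D.tauQuotient w wi - 1 +
    PowerSeries.C PowerSeries.X * PowerSeries.X * D.hankelSeries (D.der 1 F)

theorem IsDressing.diagSeries_fayDefect (h : D.IsDressing F w wi)
    (hstar : schurSeries (fun j => PowerSeries.coeff j (D.zSeries F)) =
      1 + PowerSeries.X * (PowerSeries.X * D.hshift (-1) (D.gen (D.der 1 F)))) :
    diagSeries (D.fayDefect F w wi) = 0 := by
  have hX : diagSeries (PowerSeries.X : PowerSeries (PowerSeries A)) = PowerSeries.X := by
    have := D.hshift_X 0
    rwa [hshift, RingHom.comp_apply, PowerSeries.map_X] at this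
  rw [fayDefect, map_add, map_sub, map_one, map_mul, map_mul, diagSeries_C, hX,
    diagSeries_hankelSeries, tauQuotient, map_mul, diagSeries_C, diagSeries_shift, h.diag, hstar]
  ring

theorem IsDressing.der_tauQuotient (h : D.IsDressing F w wi) :
    D.lift.lift.der 1 (D.tauQuotient w wi) =
      (D.lift.shift (-1) (D.shift (-1) (D.der 1 F)) - PowerSeries.C (D.shift (-1) (D.der 1 F)) -
        PowerSeries.map PowerSeries.C (D.shift (-1) (D.der 1 F)) +
          PowerSeries.C (PowerSeries.C (D.der 1 F))) * D.tauQuotient w wi := by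
  rw [tauQuotient, Derivation.leibniz, lift_der_shift, lift_der_C, h.der, h.der_inv, map_mul,
    map_sub, map_mul, map_sub, lift_shift_C, map_neg]
  simp only [smul_eq_mul]
  ring

/-- The z²-coefficient involves only p_2(-∂̃) = (∂_1² - ∂_2) / 2 applied to w. Dividing by w
expresses it through shifts of ∂_1 F and ∂_2 F, linearly in the latter, as the compatibility
relation requires. -/
theorem IsDressing.coeff_two_fayDefect (h : D.IsDressing F w wi) :
    PowerSeries.X * (2 * PowerSeries.coeff 2 (D.fayDefect F w wi)) =
      PowerSeries.X * (D.lift.der 1 (D.shift (-1) (D.der 1 F) - PowerSeries.C (D.der 1 F)) +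
        (D.shift (-1) (D.der 1 F) - PowerSeries.C (D.der 1 F)) ^ 2 -
          (D.shift (-1) (D.der 2 F) - PowerSeries.C (D.der 2 F))) +
      2 * (D.shift (-1) (D.der 1 F) - PowerSeries.C (D.der 1 F)) +
      2 * (PowerSeries.X * PowerSeries.C (D.der 1 (D.der 1 F))) := by
  have hs : 2 * D.lift.sop (-1) 2 w = D.lift.der 1 (D.lift.der 1 w) - D.lift.der 2 w := by
    have h2 := D.lift.sop_succ (-1) 1 w
    rw [Finset.Nat.antidiagonal_succ] at h2
    rw [Algebra.smul_def, map_natCast] at h2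
    norm_num at h2
    rw [h2, sop_one, sop_zero, neg_smul, one_smul, map_neg]
    ring
  have hT : 2 * (D.lift.sop (-1) 2 w * wi) =
      D.lift.der 1 (D.shift (-1) (D.der 1 F) - PowerSeries.C (D.der 1 F)) +
        (D.shift (-1) (D.der 1 F) - PowerSeries.C (D.der 1 F)) ^ 2 -
          (D.shift (-1) (D.der 2 F) - PowerSeries.C (D.der 2 F)) := by
    rw [← mul_assoc, hs, h.der, h.der, Derivation.leibniz, h.der]
    simp only [smul_eq_mul]
    linear_combination (D.lift.der 1 (D.shift (-1) (D.der 1 F) - PowerSeries.C (D.der 1 F)) +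
        (D.shift (-1) (D.der 1 F) - PowerSeries.C (D.der 1 F)) ^ 2 -
          (D.shift (-1) (D.der 2 F) - PowerSeries.C (D.der 2 F))) * h.mul_inv
  have hH : PowerSeries.X * (PowerSeries.X * PowerSeries.coeff 1 (D.hankelSeries (D.der 1 F))) =
      D.shift (-1) (D.der 1 F) - PowerSeries.C (D.der 1 F) +
        PowerSeries.X * PowerSeries.C (D.der 1 (D.der 1 F)) := by
    ext n
    rcases n with _ | _ | n
    · simp [constantCoeff_shift]
    · simp [PowerSeries.coeff_succ_X_mul, coeff_shift, sop_one]
    · simp [PowerSeries.coeff_succ_X_mul, coeff_shift, coeff_coeff_hankelSeries,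
        PowerSeries.coeff_X]
  have hc : PowerSeries.coeff 2 (D.fayDefect F w wi) = D.lift.sop (-1) 2 w * wi +
      PowerSeries.X * PowerSeries.coeff 1 (D.hankelSeries (D.der 1 F)) := by
    rw [fayDefect, map_add, map_sub, coeff_tauQuotient, mul_assoc, PowerSeries.coeff_C_mul,
      PowerSeries.coeff_succ_X_mul, PowerSeries.coeff_one, if_neg (by norm_num), sub_zero]
  rw [hc]
  linear_combination PowerSeries.X * hT + 2 * hH

/-- Let q be the z²-coefficient of the defect. Subtracting q(x) at t from q(x) at t - [z], and
likewise with x and z exchanged, gives the same mixed second difference of ∂_2 F both times, so ∂_2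
F cancels. What remains involves only ∂_1 and the logarithmic derivative of the tau quotient. -/
theorem IsDressing.fay_consistency (h : D.IsDressing F w wi) :
    PowerSeries.C PowerSeries.X * (PowerSeries.X *
        ((PowerSeries.map (D.shift (-1) : A →+* PowerSeries A)
            (PowerSeries.coeff 2 (D.fayDefect F w wi)) -
          PowerSeries.map PowerSeries.C (PowerSeries.coeff 2 (D.fayDefect F w wi))) -
        (D.lift.shift (-1) (PowerSeries.coeff 2 (D.fayDefect F w wi)) -
          PowerSeries.C (PowerSeries.coeff 2 (D.fayDefect F w wi))))) =
      (D.lift.shift (-1) (D.shift (-1) (D.der 1 F)) - PowerSeries.C (D.shift (-1) (D.der 1 F)) -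
        PowerSeries.map PowerSeries.C (D.shift (-1) (D.der 1 F)) +
          PowerSeries.C (PowerSeries.C (D.der 1 F))) *
        ((PowerSeries.X - PowerSeries.C PowerSeries.X) * D.fayDefect F w wi) -
      D.lift.lift.der 1 ((PowerSeries.X - PowerSeries.C PowerSeries.X) * D.fayDefect F w wi) := by
  have e := h.coeff_two_fayDefect
  have hψ : (PowerSeries.X - PowerSeries.C PowerSeries.X) * D.fayDefect F w wi =
      (PowerSeries.X - PowerSeries.C PowerSeries.X) * (D.tauQuotient w wi - 1) +
        PowerSeries.C PowerSeries.X * PowerSeries.X * (D.lift.shift (-1)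
          (PowerSeries.C (D.der 1 F)) - PowerSeries.C (D.shift (-1) (D.der 1 F))) := by
    have := D.sub_mul_hankelSeries (D.der 1 F)
    rw [fayDefect, lift_shift_C]
    linear_combination PowerSeries.C PowerSeries.X * PowerSeries.X * this
  have hd : D.lift.lift.der 1 ((PowerSeries.X - PowerSeries.C PowerSeries.X) *
      D.fayDefect F w wi) = (PowerSeries.X - PowerSeries.C PowerSeries.X) *
        D.lift.lift.der 1 (D.tauQuotient w wi) +
        PowerSeries.C PowerSeries.X * PowerSeries.X *
          (PowerSeries.map PowerSeries.C (D.shift (-1) (D.der 1 (D.der 1 F))) -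
            PowerSeries.C (D.shift (-1) (D.der 1 (D.der 1 F)))) := by
    have hm : D.lift.lift.der 1 (PowerSeries.map PowerSeries.C (D.shift (-1) (D.der 1 F))) =
        PowerSeries.map PowerSeries.C (D.shift (-1) (D.der 1 (D.der 1 F))) := by
      rw [← lift_shift_C, lift_der_shift, lift_der_C, lift_shift_C]
    rw [hψ]
    simp only [hm, map_add, map_sub, Derivation.leibniz, smul_eq_mul, lift_der_X, lift_der_C,
      lift_der_shift, Derivation.map_one_eq_zero, map_zero, lift_shift_C]
    ring
  rw [hd, hψ, h.der_tauQuotient]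
  generalize PowerSeries.coeff 2 (D.fayDefect F w wi) = q at e ⊢
  have hmapC : ∀ a : A, PowerSeries.map (D.shift (-1) : A →+* PowerSeries A) (PowerSeries.C a) =
      PowerSeries.C (D.shift (-1) a) := fun a => PowerSeries.map_C _ _
  rw [map_sub, lift_der_shift, lift_der_C] at e
  have e1 := congrArg PowerSeries.C e
  have e2 := congrArg (D.lift.shift (-1)) e
  have e3 := congrArg (PowerSeries.map PowerSeries.C) e
  have e4 := congrArg (PowerSeries.map (D.shift (-1) : A →+* PowerSeries A)) e
  simp only [map_mul, map_add, map_sub, map_pow, map_ofNat, lift_shift_X, lift_shift_C,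
    PowerSeries.map_X, map_shift_shift, hmapC] at e1 e2 e3 e4
  have hC : ∀ a : A, PowerSeries.map PowerSeries.C (PowerSeries.C a) =
      PowerSeries.C (PowerSeries.C a) := fun a => PowerSeries.map_C _ _
  simp only [hC] at e3
  rw [lift_shift_C]
  -- The formula for the z²-coefficient carries a factor 2.
  apply natCast_succ_mul_cancel 1
  push_cast
  linear_combination PowerSeries.C PowerSeries.X * (e4 - e3) - PowerSeries.X * (e2 - e1)

end CommDerivations

/-! ### From the diagonal to the full Fay identity -/

namespace CommDerivations

section Coefficients

variable {A : Type*} [CommRing A]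

/-- The coefficient of `x ^ a z ^ b`. -/
abbrev coeff₂ (a b : ℕ) (H : PowerSeries (PowerSeries A)) : A :=
  PowerSeries.coeff a (PowerSeries.coeff b H)

theorem coeff₂_mul_eq_zero {H K : PowerSeries (PowerSeries A)} {N : ℕ}
    (hH : coeff₂ 0 0 H = 0) (hK : ∀ a b, a + b < N → coeff₂ a b K = 0) {a b : ℕ}
    (hab : a + b = N) : coeff₂ a b (H * K) = 0 := by
  rw [coeff₂, PowerSeries.coeff_mul, map_sum]
  refine Finset.sum_eq_zero fun q hq => ?_
  rw [PowerSeries.coeff_mul]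
  refine Finset.sum_eq_zero fun r hr => ?_
  have hq := HasAntidiagonal.mem_antidiagonal.1 hq
  have hr := HasAntidiagonal.mem_antidiagonal.1 hr
  by_cases h : r.1 = 0 ∧ q.1 = 0
  · rw [h.1, h.2]
    exact mul_eq_zero_of_left hH _
  · exact mul_eq_zero_of_right _ (hK _ _ (by omega))

theorem coeff₂_CX_mul (a b : ℕ) (H : PowerSeries (PowerSeries A)) :
    coeff₂ (a + 1) b (PowerSeries.C PowerSeries.X * H) = coeff₂ a b H := by
  rw [coeff₂, PowerSeries.coeff_C_mul, PowerSeries.coeff_succ_X_mul]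

theorem coeff₂_zero_CX_mul (b : ℕ) (H : PowerSeries (PowerSeries A)) :
    coeff₂ 0 b (PowerSeries.C PowerSeries.X * H) = 0 := by
  rw [coeff₂, PowerSeries.coeff_C_mul, PowerSeries.coeff_zero_X_mul]

theorem coeff₂_X_mul (a b : ℕ) (H : PowerSeries (PowerSeries A)) :
    coeff₂ a (b + 1) (PowerSeries.X * H) = coeff₂ a b H := by
  rw [coeff₂, PowerSeries.coeff_succ_X_mul]

theorem coeff₂_zero_X_mul (a : ℕ) (H : PowerSeries (PowerSeries A)) :
    coeff₂ a 0 (PowerSeries.X * H) = 0 := by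
  rw [coeff₂, PowerSeries.coeff_zero_X_mul, map_zero]

theorem coeff₂_sub_mul_eq_zero {H : PowerSeries (PowerSeries A)} {N : ℕ}
    (hH : ∀ a b, a + b < N → coeff₂ a b H = 0) {a b : ℕ} (hab : a + b < N + 1) :
    coeff₂ a b ((PowerSeries.X - PowerSeries.C PowerSeries.X) * H) = 0 := by
  have h1 : coeff₂ a b (PowerSeries.X * H) = 0 := by
    rcases b with _ | b
    · exact coeff₂_zero_X_mul _ _
    · rw [coeff₂_X_mul, hH _ _ (by omega)]
  have h2 : coeff₂ a b (PowerSeries.C PowerSeries.X * H) = 0 := by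
    rcases a with _ | a
    · exact coeff₂_zero_CX_mul _ _
    · rw [coeff₂_CX_mul, hH _ _ (by omega)]
  rw [coeff₂] at h1 h2 ⊢
  rw [sub_mul, map_sub, map_sub, h1, h2, sub_zero]

end Coefficients

variable {A : Type*} [CommRing A] [Algebra ℚ A] {D : CommDerivations A} {F : A}
  {w wi : PowerSeries A}

theorem coeff₂_fayDefect_succ (a b : ℕ) :
    coeff₂ (a + 1) (b + 1) (D.fayDefect F w wi) =
      PowerSeries.coeff (a + 1) (D.lift.sop (-1) (b + 1) w * wi) +
        D.sop (-1) (a + b + 1) (D.der 1 F) := by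
  rw [coeff₂, fayDefect, map_add, map_add, map_sub, coeff_tauQuotient, mul_assoc]
  have := coeff₂_CX_mul a (b + 1) (PowerSeries.X * D.hankelSeries (D.der 1 F))
  rw [coeff₂_X_mul, coeff₂, coeff₂, coeff_coeff_hankelSeries] at this
  rw [this, PowerSeries.coeff_one, if_neg (by omega), sub_zero]

theorem IsDressing.coeff₂_fayDefect_zero_right (h : D.IsDressing F w wi) (a : ℕ) :
    coeff₂ a 0 (D.fayDefect F w wi) = 0 := by
  rw [coeff₂, fayDefect, map_add, map_sub, coeff_tauQuotient, mul_assoc, mul_left_comm,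
    PowerSeries.coeff_zero_X_mul, sop_zero, h.mul_inv, PowerSeries.coeff_zero_one, sub_self,
    add_zero, map_zero]

theorem IsDressing.constantCoeff_inv (h : D.IsDressing F w wi) :
    PowerSeries.constantCoeff wi = 1 := by
  have := congrArg PowerSeries.constantCoeff h.mul_inv
  rwa [map_mul, h.constantCoeff, one_mul, map_one] at this

theorem IsDressing.coeff₂_fayDefect_one_right (h : D.IsDressing F w wi) (a : ℕ) :
    coeff₂ (a + 1) 1 (D.fayDefect F w wi) = 0 := by
  have h1 : D.lift.sop (-1) 1 w * wi = -(D.shift (-1) (D.der 1 F) - PowerSeries.C (D.der 1 F)) := by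
    rw [sop_one, neg_smul, one_smul, h.der]
    linear_combination -(D.shift (-1) (D.der 1 F) - PowerSeries.C (D.der 1 F)) * h.mul_inv
  rw [coeff₂_fayDefect_succ, zero_add, h1, map_neg, map_sub, coeff_shift, PowerSeries.coeff_C,
    if_neg (by omega), add_zero]
  ring

theorem IsDressing.sop_mul_inv_zero (h : D.IsDressing F w wi) (b : ℕ) :
    PowerSeries.constantCoeff (D.lift.sop (-1) (b + 1) w) = 0 := by
  rw [← PowerSeries.coeff_zero_eq_constantCoeff_apply, coeff_lift_op,
    PowerSeries.coeff_zero_eq_constantCoeff_apply, h.constantCoeff]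
  exact (D.sop_const_one (-1) (b + 1)).trans (if_neg (Nat.succ_ne_zero b))

theorem IsDressing.coeff₂_fayDefect_zero_left (h : D.IsDressing F w wi) (b : ℕ) :
    coeff₂ 0 b (D.fayDefect F w wi) = 0 := by
  rcases b with _ | b
  · exact h.coeff₂_fayDefect_zero_right 0
  · have := coeff₂_zero_CX_mul (b + 1) (PowerSeries.X * D.hankelSeries (D.der 1 F))
    rw [coeff₂] at this ⊢
    rw [fayDefect, map_add, map_add, map_sub, coeff_tauQuotient, mul_assoc, this,
      PowerSeries.coeff_one, if_neg (Nat.succ_ne_zero b), sub_zero, add_zero,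
      PowerSeries.coeff_zero_eq_constantCoeff_apply, map_mul, h.sop_mul_inv_zero, zero_mul]

theorem IsDressing.coeff₂_fayDefect_one_left (h : D.IsDressing F w wi) (b : ℕ) :
    coeff₂ 1 (b + 1) (D.fayDefect F w wi) = 0 := by
  rw [coeff₂_fayDefect_succ (a := 0), PowerSeries.coeff_mul, Finset.Nat.antidiagonal_succ]
  have h1 := h.sop_mul_inv_zero b
  have h2 : PowerSeries.coeff 1 (D.lift.sop (-1) (b + 1) w) = -D.sop (-1) (b + 1) (D.der 1 F) := by
    rw [coeff_lift_op, h.coeff_one, map_neg]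
  simp [h1, h2, h.constantCoeff_inv]

/-- In `fay_consistency` the left side contributes only coefficients of the defect of degree below
N. The multiplier on the right has no constant term, so its product contributes nothing either. Only
∂_1 of the coefficient of (z - x) times the defect survives, a difference of neighbours. -/
theorem IsDressing.der_fayDefect_eq (h : D.IsDressing F w wi) {N a b : ℕ}
    (hlow : ∀ a b, a + b < N → coeff₂ a b (D.fayDefect F w wi) = 0) (hab : a + b + 5 = N) :
    D.der 1 (coeff₂ (a + 3) (b + 2) (D.fayDefect F w wi)) =
      D.der 1 (coeff₂ (a + 2) (b + 3) (D.fayDefect F w wi)) := by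
  have key := congrArg (coeff₂ (a + 3) (b + 3)) h.fay_consistency
  have hq : ∀ j, j + 2 < N →
      PowerSeries.coeff j (PowerSeries.coeff 2 (D.fayDefect F w wi)) = 0 := fun j hj => hlow _ _ hj
  rw [coeff₂_CX_mul, coeff₂_X_mul] at key
  have hL : coeff₂ (a + 2) (b + 2) ((PowerSeries.map (D.shift (-1) : A →+* PowerSeries A)
            (PowerSeries.coeff 2 (D.fayDefect F w wi)) -
          PowerSeries.map PowerSeries.C (PowerSeries.coeff 2 (D.fayDefect F w wi))) -
        (D.lift.shift (-1) (PowerSeries.coeff 2 (D.fayDefect F w wi)) -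
          PowerSeries.C (PowerSeries.coeff 2 (D.fayDefect F w wi)))) = 0 := by
    rw [coeff₂]
    simp only [map_sub, PowerSeries.coeff_map, coeff_shift, coeff_lift_op]
    rw [hq (b + 2) (by omega), hq (a + 2) (by omega), PowerSeries.coeff_C, if_neg (by omega)]
    simp
  rw [hL, coeff₂, map_sub, map_sub] at key
  have hR := coeff₂_mul_eq_zero (N := N + 1) (a := a + 3) (b := b + 3)
    (H := D.lift.shift (-1) (D.shift (-1) (D.der 1 F)) - PowerSeries.C (D.shift (-1) (D.der 1 F)) -
        PowerSeries.map PowerSeries.C (D.shift (-1) (D.der 1 F)) +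
          PowerSeries.C (PowerSeries.C (D.der 1 F)))
    (K := (PowerSeries.X - PowerSeries.C PowerSeries.X) * D.fayDefect F w wi)
    (by
      rw [coeff₂]
      simp only [map_add, map_sub, PowerSeries.coeff_map, coeff_shift, sop_zero,
        PowerSeries.coeff_zero_C]
      ring)
    (fun _ _ hab => coeff₂_sub_mul_eq_zero hlow hab) (by omega)
  rw [coeff₂] at hR
  rw [hR, zero_sub, coeff_lift_der, coeff_lift_der, sub_mul, map_sub, map_sub, map_sub] at key
  have e1 := coeff₂_X_mul (a + 3) (b + 2) (D.fayDefect F w wi)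
  have e2 := coeff₂_CX_mul (a + 2) (b + 3) (D.fayDefect F w wi)
  rw [coeff₂] at e1 e2
  rw [e1, e2] at key
  linear_combination key

/-- Dividing by w turns ∂_k into ∂_k + α_k, where α_k = (∂_k F)(t - [z]) - ∂_k F has coefficients in
I. The recursion for p_n(-∂̃) then stays inside I. -/
theorem IsDressing.coeff_sop_mul_mem (h : D.IsDressing F w wi) {I : NonUnitalSubalgebra ℚ A}
    (hI : ∀ n, ∀ f ∈ I, D.der n f ∈ I) (hF : ∀ n, D.der n F ∈ I) (n : ℕ) :
    D.lift.sop (-1) (n + 1) w * wi ∈ seriesSubalgebra I := by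
  have ha : ∀ k, D.shift (-1) (D.der k F) - PowerSeries.C (D.der k F) ∈ seriesSubalgebra I := by
    intro k i
    rw [map_sub, coeff_shift, PowerSeries.coeff_C]
    refine I.sub_mem (op_mem hI _ (hF k)) ?_
    split_ifs
    · exact hF k
    · exact I.zero_mem
  have hlift : ∀ k, ∀ f ∈ seriesSubalgebra I, D.lift.der k f ∈ seriesSubalgebra I := by
    intro k f hf i
    rw [coeff_lift_der]
    exact hI _ _ (hf i)
  induction n using Nat.strong_induction_on with
  | _ n ih =>
    have hs := congrArg (· * wi) (D.lift.sop_succ (-1) n w)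
    simp only [smul_mul_assoc] at hs
    have : D.lift.sop (-1) (n + 1) w * wi = ((n + 1 : ℕ) : ℚ)⁻¹ • (-1 : ℚ) •
        ((∑ p ∈ antidiagonal n, D.lift.der (p.1 + 1) (D.lift.sop (-1) p.2 w)) * wi) := by
      rw [← hs, inv_smul_smul₀ (by positivity)]
    rw [this]
    refine (seriesSubalgebra I).smul_mem _ ((seriesSubalgebra I).smul_mem _ ?_)
    rw [Finset.sum_mul]
    refine (seriesSubalgebra I).sum_mem fun p hp => ?_
    have hp := HasAntidiagonal.mem_antidiagonal.1 hp
    have hder : D.lift.der (p.1 + 1) (D.lift.sop (-1) p.2 w) * wi =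
        D.lift.der (p.1 + 1) (D.lift.sop (-1) p.2 w * wi) +
          (D.shift (-1) (D.der (p.1 + 1) F) - PowerSeries.C (D.der (p.1 + 1) F)) *
            (D.lift.sop (-1) p.2 w * wi) := by
      rw [Derivation.leibniz, h.der_inv]
      simp only [smul_eq_mul]
      ring
    rw [hder]
    -- At index 0 the quotient is 1, which need not belong to the non-unital I; its derivative
    -- vanishes and only α is left.
    rcases hp2 : p.2 with _ | m
    · rw [sop_zero, h.mul_inv, Derivation.map_one_eq_zero, zero_add, mul_one]
      exact ha _
    · have hm := ih m (by omega)
      exact (seriesSubalgebra I).add_mem (hlift _ _ hm) ((seriesSubalgebra I).mul_mem (ha _) hm)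

theorem IsDressing.coeff₂_fayDefect_mem (h : D.IsDressing F w wi) {I : NonUnitalSubalgebra ℚ A}
    (hI : ∀ n, ∀ f ∈ I, D.der n f ∈ I) (hF : ∀ n, D.der n F ∈ I) (a b : ℕ) :
    coeff₂ a b (D.fayDefect F w wi) ∈ I := by
  rcases b with _ | b
  · rw [h.coeff₂_fayDefect_zero_right]
    exact I.zero_mem
  rcases a with _ | a
  · rw [h.coeff₂_fayDefect_zero_left]
    exact I.zero_mem
  rw [coeff₂_fayDefect_succ]
  exact I.add_mem (h.coeff_sop_mul_mem hI hF b _) (op_mem hI _ (hF 1))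

/-- The diagonal of the differential Fay identity implies the full identity. -/
theorem IsDressing.fayDefect_eq_zero (h : D.IsDressing F w wi) {I : NonUnitalSubalgebra ℚ A}
    (hI : ∀ n, ∀ f ∈ I, D.der n f ∈ I) (hF : ∀ n, D.der n F ∈ I)
    (hinj : ∀ f ∈ I, D.der 1 f = 0 → f = 0)
    (hstar : schurSeries (fun j => PowerSeries.coeff j (D.zSeries F)) =
      1 + PowerSeries.X * (PowerSeries.X * D.hshift (-1) (D.gen (D.der 1 F)))) :
    D.fayDefect F w wi = 0 := by
  suffices H : ∀ N a b, a + b = N → coeff₂ a b (D.fayDefect F w wi) = 0 by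
    ext b a
    exact H _ a b rfl
  intro N
  induction N using Nat.strong_induction_on with
  | _ N ih =>
    have hlow : ∀ a b, a + b < N → coeff₂ a b (D.fayDefect F w wi) = 0 :=
      fun a b hab => ih _ hab a b rfl
    have hedge : ∀ a b, a < 2 ∨ b < 2 → coeff₂ a b (D.fayDefect F w wi) = 0 := by
      intro a b hab
      rcases b with _ | b
      · exact h.coeff₂_fayDefect_zero_right a
      rcases a with _ | a
      · exact h.coeff₂_fayDefect_zero_left _
      rcases b with _ | b
      · exact h.coeff₂_fayDefect_one_right a
      rcases a with _ | a
      · exact h.coeff₂_fayDefect_one_left _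
      omega
    -- Walking along the antidiagonal from the corner (2, N - 2), all interior coefficients have the
    -- same ∂_1-derivative.
    have hconst : ∀ a b, a + b + 4 = N → D.der 1 (coeff₂ (a + 2) (b + 2) (D.fayDefect F w wi)) =
        D.der 1 (coeff₂ 2 (N - 2) (D.fayDefect F w wi)) := by
      intro a
      induction a with
      | zero =>
        intro b hb
        rw [show N - 2 = b + 2 by omega]
      | succ a iha =>
        intro b hb
        rw [← iha (b + 1) (by omega)]
        exact h.der_fayDefect_eq hlow (by omega)
    have hdiag := congrArg (PowerSeries.coeff N) (h.diagSeries_fayDefect hstar)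
    rw [coeff_diagSeries, map_zero] at hdiag
    have hsum := congrArg (D.der 1) hdiag
    rw [map_sum, map_zero] at hsum
    set θ := D.der 1 (coeff₂ 2 (N - 2) (D.fayDefect F w wi)) with hθ
    have hterm : ∀ q ∈ antidiagonal N, D.der 1 (PowerSeries.coeff q.2 (PowerSeries.coeff q.1
        (D.fayDefect F w wi))) = if 2 ≤ q.1 ∧ 2 ≤ q.2 then θ else 0 := by
      intro q hq
      have hq := HasAntidiagonal.mem_antidiagonal.1 hq
      split_ifs with h2
      · have := hconst (q.2 - 2) (q.1 - 2) (by omega)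
        rwa [show q.2 - 2 + 2 = q.2 by omega, show q.1 - 2 + 2 = q.1 by omega] at this
      · have := hedge q.2 q.1 (by omega)
        rw [coeff₂] at this
        rw [this, map_zero]
    rw [Finset.sum_congr rfl hterm, ← Finset.sum_filter, Finset.sum_const] at hsum
    intro a b hab
    by_cases hab2 : a < 2 ∨ b < 2
    · exact hedge a b hab2
    -- The ∂_1-derivative of the diagonal equation is a positive integer times θ, since (a, b)
    -- itself is interior.
    have hθ0 : θ = 0 := by
      have hcard : 0 < #{q ∈ antidiagonal N | 2 ≤ q.1 ∧ 2 ≤ q.2} :=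
        Finset.card_pos.2 ⟨(a, b), Finset.mem_filter.2
          ⟨HasAntidiagonal.mem_antidiagonal.2 hab, by simp only; omega⟩⟩
      obtain ⟨m, hm⟩ := Nat.exists_eq_succ_of_ne_zero hcard.ne'
      rw [hm, nsmul_eq_mul] at hsum
      exact natCast_succ_mul_cancel m (hsum.trans (mul_zero _).symm)
    refine hinj _ (h.coeff₂_fayDefect_mem hI hF a b) ?_
    have := hconst (a - 2) (b - 2) (by omega)
    rwa [show a - 2 + 2 = a by omega, show b - 2 + 2 = b by omega, hθ0] at this

/-- The linear equations satisfied by the dressing function. -/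
theorem IsDressing.linear_equation (h : D.IsDressing F w wi) (hfay : D.fayDefect F w wi = 0)
    (k : ℕ) : PowerSeries.X * D.lift.sop (-1) (k + 2) w - D.lift.sop (-1) (k + 1) w =
      PowerSeries.X * (PowerSeries.C (D.sop (-1) (k + 1) (D.der 1 F)) * w) := by
  have hV : ∀ n, D.lift.sop (-1) (n + 1) w * wi =
      -(PowerSeries.X * PowerSeries.coeff n (D.hankelSeries (D.der 1 F))) := by
    intro n
    have := congrArg (PowerSeries.coeff (n + 1)) hfay
    rw [fayDefect, map_add, map_sub, coeff_tauQuotient, mul_assoc, PowerSeries.coeff_C_mul,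
      PowerSeries.coeff_succ_X_mul, PowerSeries.coeff_one, if_neg (by omega), sub_zero,
      map_zero] at this
    exact eq_neg_of_add_eq_zero_left this
  -- The Hankel structure: row k is its constant term plus x times row k + 1. Two consecutive rows
  -- of the Fay identity therefore combine into an equation linear in w.
  have hH : PowerSeries.coeff k (D.hankelSeries (D.der 1 F)) =
      PowerSeries.C (D.sop (-1) (k + 1) (D.der 1 F)) +
        PowerSeries.X * PowerSeries.coeff (k + 1) (D.hankelSeries (D.der 1 F)) := by
    ext a
    rcases a with _ | a
    · rw [coeff_coeff_hankelSeries, map_add, PowerSeries.coeff_zero_X_mul, PowerSeries.coeff_C,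
        if_pos rfl, add_zero, zero_add]
    · rw [coeff_coeff_hankelSeries, map_add, PowerSeries.coeff_succ_X_mul, PowerSeries.coeff_C,
        if_neg (by omega), coeff_coeff_hankelSeries, zero_add, show a + 1 + k = a + (k + 1) by omega]
  have h1 := hV (k + 1)
  have h0 := hV k
  rw [hH] at h0
  linear_combination (PowerSeries.X * h1 - h0) * w -
    (PowerSeries.X * D.lift.sop (-1) (k + 2) w - D.lift.sop (-1) (k + 1) w) * h.mul_inv

end CommDerivations

/-! ### Preparations for the dual dressing function -/

theorem exists_seq_of_prefix {A : Type*} (x : A) (T : ℕ → (ℕ → A) → A)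
    (hT : ∀ j c c', (∀ i ≤ j, c i = c' i) → T j c = T j c') :
    ∃ c : ℕ → A, c 0 = x ∧ ∀ j, c (j + 1) = T j c := by
  let s : ℕ → ℕ → A :=
    fun n => Nat.rec (fun _ => x) (fun n f => Function.update f (n + 1) (T n f)) n
  have hs : ∀ n, s (n + 1) = Function.update (s n) (n + 1) (T n (s n)) := fun n => rfl
  have hstab : ∀ n k, s (n + k) n = s n n := by
    intro n k
    induction k with
    | zero => rfl
    | succ k ih => rw [← add_assoc, hs, Function.update_of_ne (by omega), ih]
  refine ⟨fun n => s n n, rfl, fun j => ?_⟩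
  have h1 : s (j + 1) (j + 1) = T j (s j) := by rw [hs, Function.update_self]
  refine h1.trans (hT j _ _ fun i hi => ?_)
  obtain ⟨k, rfl⟩ := Nat.exists_eq_add_of_le hi
  exact hstab i k

theorem schurEval_geometric_neg_one {S : Type*} [CommRing S] [Algebra ℚ S] (n : ℕ) (x : S) :
    schurEval n (fun k => (-1 / k : ℚ) • x ^ k) =
      if n = 0 then 1 else if n = 1 then -x else 0 := by
  have hg : schurSeries (fun k : ℕ => (1 / k : ℚ) • x ^ k) * (1 - PowerSeries.C x * PowerSeries.X) =
      1 := by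
    ext n
    rw [mul_sub, mul_one, ← mul_assoc, map_sub, coeff_schurSeries, schurEval_geometric]
    rcases n with _ | n
    · simp
    · rw [PowerSeries.coeff_succ_mul_X, PowerSeries.coeff_mul_C, coeff_schurSeries,
        schurEval_geometric, PowerSeries.coeff_one, if_neg (by omega), pow_succ, sub_self]
  have hm : schurSeries (fun k : ℕ => (-1 / k : ℚ) • x ^ k) *
      schurSeries (fun k : ℕ => (1 / k : ℚ) • x ^ k) = 1 := by
    rw [← schurSeries_add]
    have : (fun k : ℕ => (-1 / k : ℚ) • x ^ k + (1 / k : ℚ) • x ^ k) = fun _ => 0 := by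
      ext1 k
      rw [← add_smul, ← add_div, neg_add_cancel, zero_div, zero_smul]
    rw [this]
    ext n
    rw [coeff_schurSeries, schurEval_const_zero, PowerSeries.coeff_one]
  have : schurSeries (fun k : ℕ => (-1 / k : ℚ) • x ^ k) = 1 - PowerSeries.C x * PowerSeries.X := by
    linear_combination (1 - PowerSeries.C x * PowerSeries.X) * hm -
      schurSeries (fun k : ℕ => (-1 / k : ℚ) • x ^ k) * hg
  rw [← coeff_schurSeries, this, map_sub, PowerSeries.coeff_one, PowerSeries.coeff_C_mul,
    PowerSeries.coeff_X]
  split_ifs <;> simp_all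

theorem twist_schurScaled_one (n : ℕ) :
    twist (schurScaled 1 n) =
      ∑ p ∈ antidiagonal n, Polynomial.monomial p.2 (schurScaled 1 p.1) := by
  rw [twist_schurScaled]
  refine Finset.sum_congr rfl fun p _ => ?_
  rw [schurEval_geometric, Polynomial.C_mul_X_pow_eq_monomial]

/-- Here exp(-∑ λ^k z^k / k) = 1 - λz, so a twist contains only two consecutive Schur operators,
matching the shape of `IsDressing.linear_equation`. -/
theorem twist_schurScaled_neg_one (n : ℕ) :
    twist (schurScaled (-1) (n + 1)) =
      Polynomial.C (schurScaled (-1) (n + 1)) - Polynomial.C (schurScaled (-1) n) * Polynomial.X := by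
  rw [twist_schurScaled, Finset.Nat.sum_antidiagonal_succ', Finset.sum_eq_single (n, 0)]
  · rw [schurEval_geometric_neg_one, schurEval_geometric_neg_one]
    simp
    ring
  · rintro ⟨i, j⟩ hij hne
    have hij := HasAntidiagonal.mem_antidiagonal.1 hij
    rw [schurEval_geometric_neg_one, if_neg (by omega), if_neg, mul_zero]
    rintro h
    exact hne (Prod.ext (by simp only at hij h ⊢; omega) (by simp only at h ⊢; omega))
  · intro h
    exact absurd (HasAntidiagonal.mem_antidiagonal.2 (by simp)) h

/-! ### Calculus of the residue pairing -/

namespace CommDerivations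

variable {A : Type*} [CommRing A] [Algebra ℚ A] (D : CommDerivations A)

theorem residue_mul_C (f c : PowerSeries A) (u : Polynomial (MvPolynomial ℕ ℚ))
    (P : MvPolynomial ℕ ℚ) :
    D.residue f c (u * Polynomial.C P) = D.residue (D.lift.op P f) c u := by
  induction u using Polynomial.induction_on' with
  | add u v hu hv => rw [add_mul, map_add, map_add, hu, hv]
  | monomial n Q => rw [Polynomial.monomial_mul_C, residue_monomial, residue_monomial, op_mul]

/-- This is zλ = 1. -/
theorem residue_X_mul (f c : PowerSeries A) (u : Polynomial (MvPolynomial ℕ ℚ)) :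
    D.residue (PowerSeries.X * f) c (u * Polynomial.X) = D.residue f c u := by
  have hX : ∀ P : MvPolynomial ℕ ℚ, D.lift.op P (PowerSeries.X * f) =
      PowerSeries.X * D.lift.op P f := by
    intro P
    ext n
    rcases n with _ | n
    · rw [coeff_lift_op, PowerSeries.coeff_zero_X_mul, PowerSeries.coeff_zero_X_mul, map_zero]
    · rw [coeff_lift_op, PowerSeries.coeff_succ_X_mul, PowerSeries.coeff_succ_X_mul, coeff_lift_op]
  induction u using Polynomial.induction_on' with
  | add u v hu hv => rw [add_mul, map_add, map_add, hu, hv]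
  | monomial n Q =>
    rw [Polynomial.monomial_mul_X, residue_monomial, residue_monomial, hX, mul_assoc,
      PowerSeries.coeff_succ_X_mul]

theorem residue_add_left (f f' c : PowerSeries A) (u : Polynomial (MvPolynomial ℕ ℚ)) :
    D.residue (f + f') c u = D.residue f c u + D.residue f' c u := by
  induction u using Polynomial.induction_on' with
  | add u v hu hv => rw [map_add, map_add, map_add, hu, hv]; ring
  | monomial n Q => simp only [residue_monomial, map_add, add_mul]

theorem residue_sub_left (f f' c : PowerSeries A) (u : Polynomial (MvPolynomial ℕ ℚ)) :
    D.residue (f - f') c u = D.residue f c u - D.residue f' c u := by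
  rw [eq_sub_iff_add_eq, ← residue_add_left, sub_add_cancel]

theorem residue_zero_left (c : PowerSeries A) (u : Polynomial (MvPolynomial ℕ ℚ)) :
    D.residue 0 c u = 0 := by
  have := D.residue_add_left 0 0 c u
  rwa [add_zero, left_eq_add] at this

theorem residue_sum_left {ι : Type*} (s : Finset ι) (f : ι → PowerSeries A) (c : PowerSeries A)
    (u : Polynomial (MvPolynomial ℕ ℚ)) :
    D.residue (∑ i ∈ s, f i) c u = ∑ i ∈ s, D.residue (f i) c u := by
  classical
  induction s using Finset.induction_on with
  | empty => simp [residue_zero_left]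
  | insert i s hi ih => rw [Finset.sum_insert hi, Finset.sum_insert hi, residue_add_left, ih]

theorem residue_sub_right (f c c' : PowerSeries A) (u : Polynomial (MvPolynomial ℕ ℚ)) :
    D.residue f (c - c') u = D.residue f c u - D.residue f c' u := by
  induction u using Polynomial.induction_on' with
  | add u v hu hv => rw [map_add, map_add, map_add, hu, hv]; ring
  | monomial n Q => simp only [residue_monomial, map_sub, mul_sub]

theorem residue_C_mul_right (f c : PowerSeries A) (a : A) (u : Polynomial (MvPolynomial ℕ ℚ)) :
    D.residue f (PowerSeries.C a * c) u = a * D.residue f c u := by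
  induction u using Polynomial.induction_on' with
  | add u v hu hv => rw [map_add, map_add, hu, hv, mul_add]
  | monomial n Q =>
    rw [residue_monomial, residue_monomial, mul_left_comm, PowerSeries.coeff_C_mul]

theorem residue_mul_twist_X_one (f c : PowerSeries A) (u : Polynomial (MvPolynomial ℕ ℚ)) :
    D.residue f c (u * twist (MvPolynomial.X 1)) =
      D.residue (D.lift.der 1 f) c u + D.residue f c (u * Polynomial.X) := by
  rw [twist_X, mul_add, map_add, residue_mul_C, op_X, pow_one]

/-- In (∂_1 + λ)^j only λ^j reaches the first possibly nonzero coefficient of e. Thus the pairing is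
triangular in the coefficients of its right argument, with leading entry the constant term of f. -/
theorem residue_pow_twist_X_one {e : PowerSeries A} (j : ℕ) :
    ∀ (f : PowerSeries A) (n : ℕ), (∀ i ≤ n + j, PowerSeries.coeff i e = 0) →
      D.residue f e (Polynomial.X ^ n * twist (MvPolynomial.X 1) ^ j) =
        PowerSeries.constantCoeff f * PowerSeries.coeff (n + j + 1) e := by
  induction j with
  | zero =>
    intro f n he
    rw [pow_zero, mul_one, Polynomial.X_pow_eq_monomial, residue_monomial, op_one,
      PowerSeries.coeff_mul, Finset.Nat.sum_antidiagonal_succ, Finset.sum_eq_zero]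
    · simp
    · intro p hp
      have hp := HasAntidiagonal.mem_antidiagonal.1 hp
      rw [he _ (by omega), mul_zero]
  | succ j ih =>
    intro f n he
    rw [pow_succ, ← mul_assoc, residue_mul_twist_X_one, ih _ _ fun i hi => he i (by omega),
      he (n + j + 1) (by omega), mul_zero, zero_add, mul_right_comm, ← pow_succ,
      ih f (n + 1) fun i hi => he i (by omega)]
    rw [show n + 1 + j + 1 = n + (j + 1) + 1 by omega]

/-- By triangularity, the j-th condition determines the coefficient j + 1 of c from the preceding
ones. -/
theorem exists_residue_pow_eq_zero {w : PowerSeries A} (hw : PowerSeries.constantCoeff w = 1) :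
    ∃ c : PowerSeries A, PowerSeries.constantCoeff c = 1 ∧
      ∀ j, D.residue w c (twist (MvPolynomial.X 1) ^ j) = 0 := by
  obtain ⟨c, h0, hc⟩ := exists_seq_of_prefix (1 : A)
    (fun j c => c (j + 1) - D.residue w (PowerSeries.mk c) (twist (MvPolynomial.X 1) ^ j)) (by
      intro j c c' h
      have := D.residue_pow_twist_X_one (e := PowerSeries.mk c - PowerSeries.mk c') j w 0 (by
        intro i hi
        rw [map_sub, PowerSeries.coeff_mk, PowerSeries.coeff_mk, h i (by omega), sub_self])
      rw [pow_zero, one_mul, residue_sub_right, hw, one_mul, zero_add, map_sub,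
        PowerSeries.coeff_mk, PowerSeries.coeff_mk] at this
      linear_combination -this)
  refine ⟨PowerSeries.mk c, ?_, fun j => ?_⟩
  · rw [← PowerSeries.coeff_zero_eq_constantCoeff_apply, PowerSeries.coeff_mk, h0]
  · linear_combination hc j

/-- The Leibniz rule moves a past (∂_1 + λ)^j at the cost of lower powers. The coefficients `e` do
not depend on f or n, which the induction needs because it changes both. -/
theorem residue_C_mul_pow (c : PowerSeries A) (j : ℕ) :
    ∀ a : A, ∃ e : ℕ → A, ∀ (f : PowerSeries A) (n : ℕ),
      D.residue (PowerSeries.C a * f) c (Polynomial.X ^ n * twist (MvPolynomial.X 1) ^ j) =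
        ∑ i ∈ range (j + 1), e i *
          D.residue f c (Polynomial.X ^ n * twist (MvPolynomial.X 1) ^ i) := by
  induction j with
  | zero =>
    intro a
    refine ⟨fun _ => a, fun f n => ?_⟩
    rw [zero_add, Finset.sum_range_one, pow_zero, mul_one, Polynomial.X_pow_eq_monomial,
      residue_monomial, residue_monomial, op_one, op_one, mul_assoc, PowerSeries.coeff_C_mul]
  | succ j ih =>
    intro a
    obtain ⟨e, he⟩ := ih a
    obtain ⟨e', he'⟩ := ih (D.der 1 a)
    refine ⟨fun i => (if i < j + 1 then e' i else 0) + (if i = 0 then 0 else e (i - 1)),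
      fun f n => ?_⟩
    have h1 : ∑ i ∈ range (j + 1), e i * D.residue (D.lift.der 1 f) c
          (Polynomial.X ^ n * twist (MvPolynomial.X 1) ^ i) +
        ∑ i ∈ range (j + 1), e i * D.residue f c
          (Polynomial.X ^ (n + 1) * twist (MvPolynomial.X 1) ^ i) =
        ∑ i ∈ range (j + 1), e i * D.residue f c
          (Polynomial.X ^ n * twist (MvPolynomial.X 1) ^ (i + 1)) := by
      rw [← Finset.sum_add_distrib]
      refine Finset.sum_congr rfl fun i _ => ?_
      rw [pow_succ (twist _), ← mul_assoc (Polynomial.X ^ n), residue_mul_twist_X_one,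
        mul_right_comm, ← pow_succ]
      ring
    rw [pow_succ (twist _), ← mul_assoc, residue_mul_twist_X_one, mul_right_comm, ← pow_succ,
      he f (n + 1), Derivation.leibniz, lift_der_C, residue_add_left, smul_eq_mul, smul_eq_mul,
      he, mul_comm f, he', add_right_comm, h1]
    simp only [add_mul, Finset.sum_add_distrib]
    rw [add_comm]
    congr 1
    · symm
      rw [Finset.sum_range_succ, if_neg (lt_irrefl _), zero_mul, add_zero]
      refine Finset.sum_congr rfl fun i hi => ?_
      rw [if_pos (Finset.mem_range.1 hi)]
    · symm
      rw [Finset.sum_range_succ']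
      simp

end CommDerivations

/-! ### Orthogonality to all constant-coefficient operators -/

namespace CommDerivations

variable {A : Type*} [CommRing A] [Algebra ℚ A] (D : CommDerivations A)

/-- The polynomials whose twists annihilate all multiples of `w` under the residue pairing
with `c`. -/
def residueKernel (w c : PowerSeries A) : Submodule ℚ (MvPolynomial ℕ ℚ) where
  carrier := {Q | ∀ a, D.residue (PowerSeries.C a * w) c (twist Q) = 0}
  add_mem' hP hQ a := by rw [map_add, map_add, hP a, hQ a, add_zero]
  zero_mem' a := by rw [map_zero, map_zero]
  smul_mem' r Q hQ a := by rw [map_smul, map_smul, hQ a, smul_zero]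

theorem residue_X_mul_sub_twist_X_one (f c : PowerSeries A)
    (u : Polynomial (MvPolynomial ℕ ℚ)) :
    D.residue (PowerSeries.X * D.lift.der 1 f + f) c (u * Polynomial.X) =
      D.residue f c (u * twist (MvPolynomial.X 1)) := by
  rw [residue_add_left, residue_X_mul, residue_mul_twist_X_one]

variable {D} {F : A} {w wi c : PowerSeries A}

/-- The twist of p_{k+2}(-ỹ) is p_{k+2} - λ p_{k+1}. Since zλ = 1, pairing aw with it amounts to
pairing (z p_{k+2} - p_{k+1})(aw) with λ. The linear equations for w reduce this to multiples of zw,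
covered by `hQ`, and to one term z∂_1(bw) + bw, covered by `hQX`. -/
theorem IsDressing.mul_schurScaled_mem (h : D.IsDressing F w wi) (hfay : D.fayDefect F w wi = 0)
    {Q : MvPolynomial ℕ ℚ} (hQ : Q ∈ D.residueKernel w c)
    (hQX : Q * MvPolynomial.X 1 ∈ D.residueKernel w c) (k : ℕ) :
    Q * schurScaled (-1) (k + 2) ∈ D.residueKernel w c := by
  intro a
  have hQ' : ∀ b, D.residue (PowerSeries.X * (PowerSeries.C b * w)) c
      (twist Q * Polynomial.X) = 0 := fun b => by rw [residue_X_mul, hQ b]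
  have e : PowerSeries.X * D.lift.sop (-1) (k + 2) (PowerSeries.C a * w) -
      D.lift.sop (-1) (k + 1) (PowerSeries.C a * w) =
      PowerSeries.X * (PowerSeries.C (D.sop (-1) (k + 2) a) * w) +
      PowerSeries.X * (PowerSeries.C (D.der 1 (D.sop (-1) (k + 1) a)) * w) -
      (PowerSeries.X * D.lift.der 1 (PowerSeries.C (D.sop (-1) (k + 1) a) * w) +
        PowerSeries.C (D.sop (-1) (k + 1) a) * w) +
      ∑ p ∈ antidiagonal k, PowerSeries.X * (PowerSeries.C
        (D.sop (-1) p.1 a * D.sop (-1) (p.2 + 1) (D.der 1 F)) * w) := by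
    have hs : ∑ p ∈ antidiagonal k, PowerSeries.X * (PowerSeries.C
        (D.sop (-1) p.1 a * D.sop (-1) (p.2 + 1) (D.der 1 F)) * w) =
        PowerSeries.X * ∑ p ∈ antidiagonal k, PowerSeries.C (D.sop (-1) p.1 a) *
          D.lift.sop (-1) (p.2 + 1 + 1) w - ∑ p ∈ antidiagonal k,
            PowerSeries.C (D.sop (-1) p.1 a) * D.lift.sop (-1) (p.2 + 1) w := by
      rw [Finset.mul_sum, ← Finset.sum_sub_distrib]
      refine Finset.sum_congr rfl fun p _ => ?_
      rw [map_mul]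
      linear_combination -PowerSeries.C (D.sop (-1) p.1 a) * h.linear_equation hfay p.2
    rw [hs, sop_mul, sop_mul, Finset.Nat.sum_antidiagonal_succ', Finset.Nat.sum_antidiagonal_succ',
      Finset.Nat.sum_antidiagonal_succ' (n := k)]
    simp only [lift_op_C, sop_zero, Derivation.leibniz, lift_der_C, smul_eq_mul, zero_add]
    rw [sop_one]
    simp only [neg_smul, one_smul]
    ring
  rw [map_mul, twist_schurScaled_neg_one, mul_sub, mul_left_comm, ← mul_assoc, mul_comm
    (Polynomial.C _ * twist Q), mul_comm (Polynomial.C _), ← mul_assoc, map_sub, residue_mul_C,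
    residue_mul_C, mul_comm Polynomial.X, ← residue_X_mul, ← residue_sub_left, e]
  rw [residue_add_left, residue_sub_left, residue_add_left, residue_sum_left, hQ', hQ',
    residue_X_mul_sub_twist_X_one, ← map_mul, hQX, Finset.sum_eq_zero fun p _ => hQ' _]
  simp

theorem IsDressing.mem_residueKernel (h : D.IsDressing F w wi) (hfay : D.fayDefect F w wi = 0)
    (hc : ∀ j, D.residue w c (twist (MvPolynomial.X 1) ^ j) = 0) (Q : MvPolynomial ℕ ℚ) :
    Q ∈ D.residueKernel w c := by
  -- Closing under powers of y_1 supplies the second hypothesis of `mul_schurScaled_mem` at every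
  -- stage.
  set G : Set (MvPolynomial ℕ ℚ) := {Q | ∀ j, Q * MvPolynomial.X 1 ^ j ∈ D.residueKernel w c}
  have hG1 : 1 ∈ G := by
    intro j a
    obtain ⟨e, he⟩ := D.residue_C_mul_pow c j a
    have := he w 0
    rw [pow_zero, one_mul] at this
    rw [one_mul, map_pow, this]
    refine Finset.sum_eq_zero fun i _ => ?_
    rw [one_mul, hc, mul_zero]
  -- The multipliers preserving G form a subalgebra. It contains y_0, y_1 and all p_n(-ỹ), hence
  -- every variable by the Newton-type recursion, so it is everything.
  let R : Subalgebra ℚ (MvPolynomial ℕ ℚ) :=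
    { carrier := {P | ∀ Q ∈ G, Q * P ∈ G}
      mul_mem' := fun {P P'} hP hP' Q hQ => by
        rw [← mul_assoc]
        exact hP' _ (hP _ hQ)
      add_mem' := fun {P P'} hP hP' Q hQ j => by
        rw [mul_add, add_mul]
        exact Submodule.add_mem _ (hP Q hQ j) (hP' Q hQ j)
      algebraMap_mem' := fun r Q hQ j => by
        rw [mul_comm Q, ← Algebra.smul_def, smul_mul_assoc]
        exact Submodule.smul_mem _ _ (hQ j) }
  have hR : ∀ P, P ∈ R ↔ ∀ Q ∈ G, Q * P ∈ G := fun P => Iff.rfl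
  have hX0 : MvPolynomial.X 0 ∈ R := by
    rw [hR]
    intro Q hQ j a
    rw [mul_right_comm, map_mul, twist_X, pow_zero, mul_add, mul_one, map_add, hQ j a, add_zero,
      mul_comm (twist _), residue_C_X_zero_mul]
  have hX1 : MvPolynomial.X 1 ∈ R := by
    rw [hR]
    intro Q hQ j
    rw [mul_assoc, ← pow_succ']
    exact hQ (j + 1)
  have hS : ∀ n, schurScaled (-1) n ∈ R := by
    intro n
    rcases n with _ | _ | k
    · rw [schurScaled_zero]
      exact R.one_mem
    · rw [zero_add, schurScaled_one]
      exact R.smul_mem hX1 _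
    · rw [hR]
      intro Q hQ j
      rw [mul_right_comm]
      refine h.mul_schurScaled_mem hfay (hQ j) ?_ k
      rw [mul_assoc, ← pow_succ]
      exact hQ (j + 1)
  have hX : ∀ n, MvPolynomial.X n ∈ R := by
    intro n
    induction n using Nat.strong_induction_on with
    | _ n ih =>
      rcases n with _ | n
      · exact hX0
      · have hs := schurScaled_succ (-1) n
        rw [neg_smul, one_smul, ← Finset.sum_erase_add _ _
          (HasAntidiagonal.mem_antidiagonal.2 (add_zero n) : (n, 0) ∈ antidiagonal n),
          schurScaled_zero, mul_one] at hs
        have : (MvPolynomial.X (n + 1) : MvPolynomial ℕ ℚ) =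
            -(((n + 1 : ℕ) : ℚ) • schurScaled (-1) (n + 1) +
              ∑ p ∈ (antidiagonal n).erase (n, 0),
                MvPolynomial.X (p.1 + 1) * schurScaled (-1) p.2) := by
          rw [hs]
          ring
        rw [this]
        refine R.neg_mem (R.add_mem (R.smul_mem (hS _) _) (R.sum_mem fun p hp => ?_))
        obtain ⟨hne, hp⟩ := Finset.mem_erase.1 hp
        have hp := HasAntidiagonal.mem_antidiagonal.1 hp
        have hp1 : p.1 < n := by
          by_contra hlt
          exact hne (Prod.ext (by simp only; omega) (by simp only; omega))
        exact R.mul_mem (ih _ (by omega)) (hS _)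
  have hQ : Q ∈ R := by
    induction Q using MvPolynomial.induction_on with
    | C r => exact R.algebraMap_mem r
    | add P Q hP hQ => exact R.add_mem hP hQ
    | mul_X P n hP => exact R.mul_mem hP (hX n)
  have := hQ 1 hG1 0
  rwa [one_mul, pow_zero, mul_one] at this

/-- The dual dressing function is determined by its residues against all shifts. -/
theorem hshift_mul_eq_one (hw : PowerSeries.constantCoeff w = 1)
    (hc0 : PowerSeries.constantCoeff c = 1)
    (hc : ∀ Q, D.residue w c (twist Q) = 0) : D.hshift 1 w * c = 1 := by
  have hd : D.hshift 1 w * c = diagSeries (D.lift.shift 1 w * PowerSeries.C c) := by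
    rw [map_mul, diagSeries_shift, diagSeries_C]
  ext n
  rw [PowerSeries.coeff_one]
  rcases n with _ | n
  · rw [if_pos rfl, PowerSeries.coeff_zero_eq_constantCoeff_apply, map_mul, hc0, mul_one,
      ← PowerSeries.coeff_zero_eq_constantCoeff_apply, coeff_hshift]
    simp [sop_zero, hw]
  -- The twist of p_n(ỹ) is ∑ p_i(ỹ) λ^j with i + j = n. Its residue is the coefficient n + 1 of the
  -- diagonal product, except for the term p_{n+1} acting on the constant term 1 of w, which
  -- vanishes.
  · have h1 := hc (schurScaled 1 n)
    rw [twist_schurScaled_one, map_sum] at h1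
    have hn : D.sop 1 (n + 1) 1 = 0 := by rw [sop_const_one, if_neg (by omega)]
    rw [if_neg (by omega), hd, coeff_diagSeries, Finset.Nat.sum_antidiagonal_succ']
    rw [PowerSeries.coeff_mul_C, coeff_shift, PowerSeries.coeff_zero_eq_constantCoeff_apply,
      map_mul, ← PowerSeries.coeff_zero_eq_constantCoeff_apply (D.lift.op _ _), coeff_lift_op,
      PowerSeries.coeff_zero_eq_constantCoeff_apply, hw, hn, zero_mul, zero_add, ← h1]
    refine Finset.sum_congr rfl fun p _ => ?_
    rw [residue_monomial, PowerSeries.coeff_mul_C, coeff_shift]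

/-- The equations for `log τ` imply the bilinear residue identity. -/
theorem IsLog.residue_eq_zero {τ : A} (h : D.IsLog τ F) (hτ : IsUnit τ)
    {I : NonUnitalSubalgebra ℚ A} (hI : ∀ n, ∀ f ∈ I, D.der n f ∈ I) (hF : ∀ n, D.der n F ∈ I)
    (hinj : ∀ f ∈ I, D.der 1 f = 0 → f = 0)
    (hstar : schurSeries (fun j => PowerSeries.coeff j (D.zSeries F)) =
      1 + PowerSeries.X * (PowerSeries.X * D.hshift (-1) (D.gen (D.der 1 F))))
    (Q : MvPolynomial ℕ ℚ) :
    D.residue (D.shift (-1) τ) (D.shift 1 τ) (twist Q) = 0 := by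
  obtain ⟨w, wi, hw, hd⟩ := h.exists_dressing hτ
  have hfay := hd.fayDefect_eq_zero hI hF hinj hstar
  obtain ⟨c, hc0, hc⟩ := D.exists_residue_pow_eq_zero hd.constantCoeff
  have hker := hd.mem_residueKernel hfay hc
  have hone : D.hshift 1 w * c = 1 := by
    refine hshift_mul_eq_one hd.constantCoeff hc0 fun Q => ?_
    have := hker Q 1
    rwa [map_one, one_mul] at this
  -- Shifting w τ(t) = τ(t - [z]) by [z] gives w(t + [z]) τ(t + [z]) = τ(t). As c inverts w(t +
  -- [z]), it equals τ(t + [z]) / τ(t).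
  have hw1 := congrArg (D.hshift 1) hw
  rw [map_mul, hshift_C, hshift_shift, add_neg_cancel, shift_zero_left] at hw1
  have hcτ : D.shift 1 τ = PowerSeries.C τ * c := by
    linear_combination c * hw1 - D.shift 1 τ * hone
  rw [hcτ, residue_C_mul_right, ← hw, mul_comm w, hker Q τ, mul_zero]

end CommDerivations

/-! ### The equations in u -/

section Translation

variable {A : Type*} [CommRing A] [Algebra ℚ A] {d : ℕ → Derivation ℚ A A}
  {hcomm : ∀ m n, 1 ≤ m → 1 ≤ n → ∀ f, d m (d n f) = d n (d m f)}

theorem CommDerivations.sop_succ_mem {D : CommDerivations A} {I : NonUnitalSubalgebra ℚ A}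
    (hI : ∀ n, ∀ f ∈ I, D.der n f ∈ I) {F : A} (hF : ∀ n, D.der n F ∈ I) (c : ℚ) (n : ℕ) :
    D.sop c (n + 1) F ∈ I := by
  rw [← inv_smul_smul₀ (show ((n + 1 : ℕ) : ℚ) ≠ 0 by positivity) (D.sop c (n + 1) F), sop_succ]
  refine I.smul_mem _ (I.smul_mem _ (I.sum_mem fun p _ => ?_))
  rw [← op_der]
  exact op_mem hI _ (hF _)

theorem zSum_der (hcomm : ∀ m n, 1 ≤ m → 1 ≤ n → ∀ f, d m (d n f) = d n (d m f)) (f : A)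
    (j : ℕ) : d 1 (zSum d f j) = zSum d (d 1 f) j := by
  rw [zSum_eq (hcomm := hcomm), zSum_eq (hcomm := hcomm), CommDerivations.coeff_zSeries,
    CommDerivations.coeff_zSeries, ← CommDerivations.mk'_der (hcomm := hcomm) le_rfl, map_sum]
  simp only [CommDerivations.op_der]

theorem rSum_der (hcomm : ∀ m n, 1 ≤ m → 1 ≤ n → ∀ f, d m (d n f) = d n (d m f)) (f : A)
    (i : ℕ) : d 1 (rSum d f i) = rSum d (d 1 f) i := by
  rw [rSum, rSum, map_sum]
  refine Finset.sum_congr rfl fun p hp => ?_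
  rw [schurOp_eq (hcomm := hcomm), ← CommDerivations.mk'_der (hcomm := hcomm) le_rfl,
    ← CommDerivations.mk'_der (hcomm := hcomm) (Finset.mem_filter.1 hp).2,
    ← CommDerivations.op_der, CommDerivations.der_comm]

theorem zSum_mem {I : NonUnitalSubalgebra ℚ A}
    (hI : ∀ n, ∀ f ∈ I, (CommDerivations.mk' d hcomm).der n f ∈ I) {F : A}
    (hF : ∀ n, (CommDerivations.mk' d hcomm).der n F ∈ I) (j : ℕ) : zSum d F j ∈ I := by
  rw [zSum]
  refine I.sum_mem fun p hp => ?_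
  obtain ⟨m, hm⟩ := Nat.exists_eq_add_of_le (Finset.mem_filter.1 hp).2.2
  rw [schurOp_eq (hcomm := hcomm), schurOp_eq (hcomm := hcomm), hm, add_comm]
  exact CommDerivations.op_mem hI _ (CommDerivations.sop_succ_mem hI hF _ _)

theorem rSum_mem {I : NonUnitalSubalgebra ℚ A}
    (hI : ∀ n, ∀ f ∈ I, (CommDerivations.mk' d hcomm).der n f ∈ I) {f : A} (hf : f ∈ I) (i : ℕ) :
    rSum d f i ∈ I := by
  rw [rSum]
  refine I.sum_mem fun p hp => ?_
  rw [schurOp_eq (hcomm := hcomm),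
    ← CommDerivations.mk'_der (hcomm := hcomm) (Finset.mem_filter.1 hp).2]
  exact CommDerivations.op_mem hI _ (hI _ _ hf)

/-- Both sides of (*) for F are built from elements of I, so injectivity of ∂_1 forces the
antiderivatives in the u-equations to be the Z_j and right-hand sides of F. -/
theorem uEquations_iff {I : NonUnitalSubalgebra ℚ A}
    (hI : ∀ n, ∀ f ∈ I, (CommDerivations.mk' d hcomm).der n f ∈ I) {F : A}
    (hF : ∀ n, (CommDerivations.mk' d hcomm).der n F ∈ I)
    (hinj : ∀ f ∈ I, d 1 f = 0 → f = 0) :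
    UEquations d I (d 1 (d 1 F)) ↔ LogTauEquations d F := by
  have hd1 : (CommDerivations.mk' d hcomm).der 1 = d 1 := CommDerivations.mk'_der le_rfl
  have hinj' : ∀ f ∈ I, ∀ g ∈ I, d 1 f = d 1 g → f = g := fun f hf g hg h =>
    sub_eq_zero.1 (hinj _ (I.sub_mem hf hg) (by rw [map_sub, h, sub_self]))
  have hI1 : ∀ f ∈ I, d 1 f ∈ I := fun f hf => hd1 ▸ hI 1 f hf
  have hF1 : d 1 F ∈ I := hd1 ▸ hF 1
  constructor
  · rintro ⟨Z, R, hZ, hR, h⟩ i hi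
    have hZ' : Z = zSum d F := by
      ext1 j
      have hz := zSum_mem hI hF j
      refine hinj' _ (hZ j).1 _ hz (hinj' _ (hI1 _ (hZ j).1) _ (hI1 _ hz) ?_)
      rw [(hZ j).2, zSum_der hcomm, zSum_der hcomm]
    rw [← hZ', h i hi]
    refine hinj' _ (hR i).1 _ (rSum_mem hI hF1 i) ?_
    rw [(hR i).2, rSum_der hcomm]
  · intro h
    refine ⟨zSum d F, rSum d (d 1 F), fun j => ⟨zSum_mem hI hF j, ?_⟩,
      fun i => ⟨rSum_mem hI hF1 i, rSum_der hcomm _ _⟩, h⟩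
    rw [zSum_der hcomm, zSum_der hcomm]

end Translation

end

theorem mainTheorem1 {A : Type*} [CommRing A] [Algebra ℚ A]
    -- commuting derivations `∂_1, ∂_2, …` (index `0` is not used)
    (d : ℕ → Derivation ℚ A A)
    (hcomm : ∀ m n, 1 ≤ m → 1 ≤ n → ∀ f, d m (d n f) = d n (d m f))
    -- `τ` and `F = log τ`
    (τ F : A) (hτ : IsUnit τ) (hF : ∀ n, 1 ≤ n → d n τ = τ * d n F) :
    (KPHirota d τ → LogTauEquations d F) ∧
    -- a class `I` of functions on which `∂_1⁻¹` is unambiguous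
    ∀ I : NonUnitalSubalgebra ℚ A,
      (∀ n, 1 ≤ n → ∀ f ∈ I, d n f ∈ I) →
      (∀ f ∈ I, d 1 f = 0 → f = 0) →
      (∀ n, 1 ≤ n → d n F ∈ I) →
      (KPHirota d τ ↔ LogTauEquations d F) ∧
      (KPHirota d τ ↔ UEquations d I (d 1 (d 1 F))) := by
  have hder : ∀ n, 1 ≤ n → (CommDerivations.mk' d hcomm).der n = d n :=
    fun n hn => CommDerivations.mk'_der hn
  have h0 : ∀ f, (CommDerivations.mk' d hcomm).der 0 f = 0 := fun f => by
    rw [CommDerivations.der_zero, Derivation.zero_apply]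
  have hlog : (CommDerivations.mk' d hcomm).IsLog τ F := by
    intro n
    rcases Nat.eq_zero_or_pos n with rfl | hn
    · rw [h0, h0, mul_zero]
    · rw [hder n hn, hF n hn]
  have ha : KPHirota d τ → LogTauEquations d F := fun h =>
    (logTauEquations_iff (hcomm := hcomm) F).2
      (hlog.schurSeries_eq hτ ((kpHirota_iff (hcomm := hcomm) τ).1 h))
  refine ⟨ha, fun I hI hinj hFI => ?_⟩
  have hI' : ∀ n, ∀ f ∈ I, (CommDerivations.mk' d hcomm).der n f ∈ I := by
    intro n f hf
    rcases Nat.eq_zero_or_pos n with rfl | hn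
    · rw [h0]
      exact I.zero_mem
    · rw [hder n hn]
      exact hI n hn f hf
  have hFI' : ∀ n, (CommDerivations.mk' d hcomm).der n F ∈ I := by
    intro n
    rcases Nat.eq_zero_or_pos n with rfl | hn
    · rw [h0]
      exact I.zero_mem
    · rw [hder n hn]
      exact hFI n hn
  have hb : KPHirota d τ ↔ LogTauEquations d F := ⟨ha, fun h =>
    (kpHirota_iff (hcomm := hcomm) τ).2 (hlog.residue_eq_zero hτ hI' hFI'
      (fun f hf => by rw [hder 1 le_rfl]; exact hinj f hf)
      ((logTauEquations_iff (hcomm := hcomm) F).1 h))⟩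
  exact ⟨hb, hb.trans (uEquations_iff hI' hFI' hinj).symm⟩
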